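/- Let $F$ be an arbitrary field with algebraic closure $\overline F$, let $p,q\in F[t]$ be monic polynomials of degree $2$, and set $\delta:=\operatorname{tr}p-\operatorname{tr}q$, where the trace of a monic polynomial of degree $2$ is the opposite of its coefficient on $t$. All vector spaces are finite-dimensional over $F$. Put $F_{p,q}(t):=\operatorname{res}_x\bigl(p(x),q(x-t)\bigr)\in F[t]$; an endomorphism $u$ of $V$ is called $(p,q)$-regular if $\bigcap_{n\ge 0}\operatorname{im}F_{p,q}(u)^n=V$ (equivalently, no eigenvalue of $u$ in $\overline F$ is the difference of a root of $p$ and a root of $q$). A symplectic pair $(b,u)$ on $V$ consists of a symplectic form $b$ on $V$ and an endomorphism $u$ of $V$ that is $b$-alternating, i.e. $b(x,u(x))=0$ for all $x\in V$; it is trivial if $V=\{0\}$, and $(p,q)$-regular if $u$ is. It is a symplectic $(p,q)$-difference if $u=u_1-u_2$ for some $b$-alternating endomorphisms $u_1,u_2$ of $V$ with $p(u_1)=q(u_2)=0$. An isometry from $(b,u)$ to $(b',u')$ is a linear isomorphism $\varphi$ with $b'(\varphi(x),\varphi(y))=b(x,y)$ and $u'\circ\varphi=\varphi\circ u$. The orthogonal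 direct sum of $(b,u)$ on $V$ and $(b',u')$ on $V'$ is the pair on $V\times V'$ formed by the orthogonal sum $b\perp b'$ and $u\oplus u'$. A symplectic $(p,q)$-difference is indecomposable if it is nontrivial and not isometric to the orthogonal direct sum of two nontrivial symplectic $(p,q)$-differences. For an endomorphism $v$ of $V$, its symplectic extension is the symplectic pair $S(v)=(S_V,h(v))$ on $V\times V^\star$, where $S_V\bigl((x,\varphi),(y,\psi)\bigr)=\varphi(y)-\psi(x)$ and $h(v)(x,\varphi)=(v(x),\varphi\circ v)$; the invariant factors of $S(v)$ are those of $h(v)$. For a nonconstant monic polynomial $s=t^m-\sum_{k<m}a_kt^k$, $C(s)$ denotes its $m\times m$ companion matrix, with ones just below the diagonal, last column $(a_0,\dots,a_{m-1})^T$ and zeros elsewhere. (1) Let $v$ be a $(p,q)$-regular endomorphism of a vector space. The following conditions are equivalent: (i) $S(v)$ is a symplectic $(p,q)$-difference; (ii) all the invariant factors of $v$ are polynomials in $t^2-\delta t$; (iii) all the invariant factors of $S(v)$ are polynomials in $t^2-\delta t$. (2) Let $n\ge 1$ be an integer and $r\in F[t]$ an irreducible monic polynomial such that $r(t^2-\delta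 t)$ has no root of the form $x-y$ with $x,y\in\overline F$, $p(x)=0$ and $q(y)=0$. If $v$ is an endomorphism that is represented in some basis by the companion matrix $C\bigl(r^n(t^2-\delta t)\bigr)$, then $S(v)$ is a $(p,q)$-regular indecomposable symplectic $(p,q)$-difference. (3) Conversely, every $(p,q)$-regular indecomposable symplectic $(p,q)$-difference is isometric to $S(v)$ for an endomorphism $v$ represented by $C\bigl(r^n(t^2-\delta t)\bigr)$ for some $n$ and $r$ as in (2). -/

import Mathlib

open Polynomial

namespace SymplecticDifference

noncomputable section

section Polynomials

variable {F : Type*} [Field F]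

/-- The trace of a monic polynomial of degree `n > 0`: the opposite of its coefficient on
`t ^ (n - 1)`, i.e. the sum of its roots counted with multiplicities. -/
def polyTrace (p : F[X]) : F :=
  -p.coeff (p.natDegree - 1)

/-- `δ = tr p - tr q`. -/
def delta (p q : F[X]) : F :=
  polyTrace p - polyTrace q

/-- The polynomial `t ^ 2 - δ t`. -/
def quadPoly (p q : F[X]) : F[X] :=
  X ^ 2 - C (delta p q) * X

/-- `f` is a polynomial in `t ^ 2 - δ t`. -/
def IsPolyInQuad (p q f : F[X]) : Prop :=
  ∃ r : F[X], f = r.comp (quadPoly p q)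

/-- The fundamental polynomial `F_{p,q}(t) = res (p(x), q(x - t))`, the resultant being taken with
respect to the variable `x`. In `F[X][X]` the outer variable is `x` and the inner one is `t`. -/
def fundamentalPoly (p q : F[X]) : F[X] :=
  resultant (p.map C) ((q.map C).comp (X - C X))

/-- The companion matrix of a monic polynomial `r = t ^ n - ∑ k < n, a k * t ^ k`: ones just below
the diagonal, and last column `a 0, …, a (n - 1)`. -/
def companionMatrix (r : F[X]) : Matrix (Fin r.natDegree) (Fin r.natDegree) F :=
  Matrix.of fun i j =>
    if (j : ℕ) + 1 = r.natDegree then -r.coeff i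
    else if (i : ℕ) = (j : ℕ) + 1 then 1
    else 0

end Polynomials

section Endomorphisms

variable {F V : Type*} [Field F] [AddCommGroup V] [Module F V]

/-- The sequence `f 0, f 1, …, f (k - 1)` is the sequence of (nontrivial) invariant factors of `u`:
these are nonconstant monic polynomials, each one dividing the preceding one, and `V`, seen as an
`F[X]`-module on which `X` acts as `u`, is isomorphic to the direct sum of the `F[X] / (f i)`. -/
structure HasInvariantFactors (u : Module.End F V) {k : ℕ} (f : Fin k → F[X]) : Prop where
  monic : ∀ i, (f i).Monic
  natDegree_pos : ∀ i, 0 < (f i).natDegree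
  dvd : ∀ i j, i ≤ j → f j ∣ f i
  equiv : Nonempty (Module.AEval' u ≃ₗ[F[X]] ((i : Fin k) → F[X] ⧸ Ideal.span {f i}))

/-- `g` is one of the invariant factors of `u`. -/
def IsInvariantFactor (u : Module.End F V) (g : F[X]) : Prop :=
  ∃ (k : ℕ) (f : Fin k → F[X]), HasInvariantFactors u f ∧ ∃ i, f i = g

/-- The subspace `R_{p,q}(u)`, the intersection of the ranges of the powers of `F_{p,q}(u)`. -/
def regularPart (p q : F[X]) (u : Module.End F V) : Submodule F V :=
  ⨅ n : ℕ, LinearMap.range ((aeval u (fundamentalPoly p q)) ^ n)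

/-- `u` is `(p,q)`-regular. -/
def IsRegular (p q : F[X]) (u : Module.End F V) : Prop :=
  regularPart p q u = ⊤

end Endomorphisms

/-- A symplectic pair on `V`: a symplectic form `b` together with a `b`-alternating
endomorphism `u`. -/
structure SymplecticPair (F V : Type*) [Field F] [AddCommGroup V] [Module F V] where
  form : LinearMap.BilinForm F V
  endo : Module.End F V
  isAlt : form.IsAlt
  nondegenerate : form.Nondegenerate
  endo_alternating : ∀ x, form x (endo x) = 0

namespace SymplecticPair

section

variable {F V W : Type*} [Field F] [AddCommGroup V] [Module F V] [AddCommGroup W] [Module F W]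

/-- `(b,u)` is a symplectic `(p,q)`-difference. -/
def IsDifference (p q : F[X]) (s : SymplecticPair F V) : Prop :=
  ∃ u₁ u₂ : Module.End F V,
    (∀ x, s.form x (u₁ x) = 0) ∧ (∀ x, s.form x (u₂ x) = 0) ∧
      aeval u₁ p = 0 ∧ aeval u₂ q = 0 ∧ s.endo = u₁ - u₂

/-- Isometry of symplectic pairs. -/
def Isometric (s : SymplecticPair F V) (s' : SymplecticPair F W) : Prop :=
  ∃ φ : V ≃ₗ[F] W,
    (∀ x y, s'.form (φ x) (φ y) = s.form x y) ∧ ∀ x, s'.endo (φ x) = φ (s.endo x)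

/-- The orthogonal direct sum of two bilinear forms. -/
def orthogonalSumForm (b : LinearMap.BilinForm F V) (b' : LinearMap.BilinForm F W) :
    LinearMap.BilinForm F (V × W) :=
  b.compl₁₂ (LinearMap.fst F V W) (LinearMap.fst F V W) +
    b'.compl₁₂ (LinearMap.snd F V W) (LinearMap.snd F V W)

@[simp]
theorem orthogonalSumForm_apply (b : LinearMap.BilinForm F V) (b' : LinearMap.BilinForm F W)
    (x y : V × W) : orthogonalSumForm b b' x y = b x.1 y.1 + b' x.2 y.2 := rfl

/-- The orthogonal direct sum of two symplectic pairs. -/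
def orthogonalSum (s : SymplecticPair F V) (s' : SymplecticPair F W) :
    SymplecticPair F (V × W) where
  form := orthogonalSumForm s.form s'.form
  endo := s.endo.prodMap s'.endo
  isAlt := fun x => by
    simp [s.isAlt.self_eq_zero, s'.isAlt.self_eq_zero]
  nondegenerate := by
    refine ⟨fun x hx => ?_, fun x hx => ?_⟩
    · exact Prod.ext (s.nondegenerate.1 _ fun y => by simpa using hx (y, 0))
        (s'.nondegenerate.1 _ fun y => by simpa using hx (0, y))
    · exact Prod.ext (s.nondegenerate.2 _ fun y => by simpa using hx (y, 0))
        (s'.nondegenerate.2 _ fun y => by simpa using hx (0, y))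
  endo_alternating := fun x => by
    simp [s.endo_alternating, s'.endo_alternating]

variable (F V) in
/-- The standard symplectic form `S_V` on `V × V*`, given by
`((x, φ), (y, ψ)) ↦ φ y - ψ x`. -/
def standardForm : LinearMap.BilinForm F (V × Module.Dual F V) :=
  LinearMap.mk₂ F (fun z w => z.2 w.1 - w.2 z.1)
    (fun a b c => by simp; ring) (fun a b c => by simp; ring)
    (fun a b c => by simp; ring) (fun a b c => by simp; ring)

@[simp]
theorem standardForm_apply (z w : V × Module.Dual F V) :
    standardForm F V z w = z.2 w.1 - w.2 z.1 := rfl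

/-- The symplectic extension `S(v) = (S_V, h(v))` of an endomorphism `v` of `V`, where
`h(v) = v ⊕ vᵗ` acts on `V × V*`. -/
def extension (v : Module.End F V) : SymplecticPair F (V × Module.Dual F V) where
  form := standardForm F V
  endo := v.prodMap v.dualMap
  isAlt := fun z => by simp
  nondegenerate := by
    refine ⟨fun z hz => ?_, fun z hz => ?_⟩
    · refine Prod.ext ((Module.forall_dual_apply_eq_zero_iff F z.1).1 fun φ => ?_)
        (LinearMap.ext fun y => ?_)
      · simpa using hz (0, φ)
      · simpa using hz (y, 0)
    · refine Prod.ext ((Module.forall_dual_apply_eq_zero_iff F z.1).1 fun φ => ?_)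
        (LinearMap.ext fun y => ?_)
      · simpa using hz (0, φ)
      · simpa using hz (y, 0)
  endo_alternating := fun z => by simp [LinearMap.dualMap_apply]

end

universe u v

/-- `(b,u)` is an indecomposable symplectic `(p,q)`-difference: it is a nontrivial symplectic
`(p,q)`-difference and it is not isometric to the orthogonal direct sum of two nontrivial
symplectic `(p,q)`-differences. -/
def IsIndecomposableDifference {F : Type u} {V : Type v} [Field F] [AddCommGroup V] [Module F V]
    (p q : F[X]) (s : SymplecticPair F V) : Prop :=
  Nontrivial V ∧ s.IsDifference p q ∧
    ∀ (V₁ V₂ : Type v) [AddCommGroup V₁] [AddCommGroup V₂] [Module F V₁] [Module F V₂]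
      [FiniteDimensional F V₁] [FiniteDimensional F V₂] [Nontrivial V₁] [Nontrivial V₂]
      (s₁ : SymplecticPair F V₁) (s₂ : SymplecticPair F V₂),
      s₁.IsDifference p q → s₂.IsDifference p q → ¬ s.Isometric (s₁.orthogonalSum s₂)

end SymplecticPair

/-- The data attached to the indecomposable regular symplectic `(p,q)`-differences: a positive
integer `n` and an irreducible monic polynomial `r` such that `r(t ^ 2 - δ t)` has no root
in `Root(p) - Root(q)`, roots being taken in the algebraic closure. -/
structure IsRegularDatum {F : Type*} [Field F] (p q : F[X]) (n : ℕ) (r : F[X]) : Prop where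
  pos : 0 < n
  monic : r.Monic
  irreducible : Irreducible r
  no_root : ∀ x ∈ p.rootSet (AlgebraicClosure F), ∀ y ∈ q.rootSet (AlgebraicClosure F),
    aeval (x - y) (r.comp (quadPoly p q)) ≠ 0

/-- The matrix `C(r ^ n (t ^ 2 - δ t))`. -/
def regularMatrix {F : Type*} [Field F] (p q : F[X]) (n : ℕ) (r : F[X]) :
    Matrix (Fin ((r ^ n).comp (quadPoly p q)).natDegree)
      (Fin ((r ^ n).comp (quadPoly p q)).natDegree) F :=
  companionMatrix ((r ^ n).comp (quadPoly p q))

end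

end SymplecticDifference

/-!
# Regular symplectic differences of quadratic elements

Put `Q = t ^ 2 - δ t`, and let `σ` be the involution `t ↦ δ - t` of `F[t]`. The bridge between
differences and invariant factors is the notion of a *balanced* endomorphism (`IsBalanced`): the
kernels of `g(u)` and `σ(g)(u)` have the same dimension for every polynomial `g`, and the
elementary divisors of `u` attached to the irreducible polynomials that ramify over `F[Q]` have
even exponents. This amounts to saying that all the invariant factors of `u` are polynomials in
`Q` (`isBalanced_of_forall_isCompQuad`, `isCompQuad_of_isBalanced`), and it is visibly compatible
with direct sums, with cancellation and with transposition, whence `isBalanced_extension_iff`.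

If `u = u₁ - u₂` with `p(u₁) = q(u₂) = 0`, then `u₁ u = (δ - u) u₁ + w(u)` for an explicit
polynomial `w` of degree `2`, and the commutator of `u₁` and `u₂` intertwines `u` and `δ - u` and
has square `F_{p,q}(u)` (`exists_mul_self_eq_aeval_fundamentalPoly`). When `u` is regular, the
commutator is invertible, which gives the symmetry of the kernels, and the first identity is a
twisted derivation which gives the parity of the exponents. So regular differences are balanced
(`isBalanced_of_isDifference`).

Conversely, let `(b, u)` be a nonzero balanced symplectic pair. The minimal polynomial of `u` is a
polynomial in `Q`, and some vector `x` has order `h = r ^ n (Q)`, where `r` is irreducible and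
`r ^ n (Q)` is the exact power of `r(Q)` in that polynomial. Cyclic subspaces are totally
isotropic because `u` is alternating, and `b` pairs the cyclic subspace of `x` perfectly with
another one; both span a copy of the symplectic extension of the companion matrix of `h`
(`exists_hyperbolic_embedding`). This copy splits off, with a balanced complement
(`exists_isometric_orthogonalSum_extension`). The extension of a cyclic endomorphism with minimal
polynomial `r ^ n (Q)` is a difference: it is realized by left multiplications in the quaternion
algebra over `F[γ] / (r ^ n)` generated by `a` and `b` with `p(a) = q(b) = 0` and `Q(a - b) = γ`
(`isDifference_extension_of_isCyclicVector`). By induction on the dimension, every balanced pair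
is a difference (`isDifference_of_isBalanced`), and an indecomposable one is a single summand.
Such a summand is indecomposable because, in each nonzero balanced pair annihilated by a power of
`r(Q)`, the kernel of `r(Q)(u)` has dimension at least twice the degree of `r(Q)`, with equality
for a single summand.
-/

open Polynomial

namespace SymplecticDifference

noncomputable section

/-! ### Polynomials in `t ^ 2 - δ t` -/

section PolynomialsInQuad

variable {F : Type*} [Field F]

/-- The polynomial `t ^ 2 - δ t`. -/
def quad (δ : F) : F[X] := X ^ 2 - C δ * X

/-- `f` is a polynomial in `t ^ 2 - δ t`. -/
def IsCompQuad (δ : F) (f : F[X]) : Prop := ∃ r : F[X], f = r.comp (quad δ)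

/-- The involution `t ↦ δ - t` of `F[t]`, whose fixed points include `t ^ 2 - δ t`. -/
def reflect (δ : F) : F[X] →ₐ[F] F[X] := aeval (C δ - X)

theorem quad_eq (δ : F) : quad δ = X * (X - C δ) := by unfold quad; ring

theorem natDegree_quad (δ : F) : (quad δ).natDegree = 2 := by
  rw [quad_eq, natDegree_mul X_ne_zero (X_sub_C_ne_zero δ), natDegree_X, natDegree_X_sub_C]

theorem monic_quad (δ : F) : (quad δ).Monic := by
  rw [quad_eq]; exact monic_X.mul (monic_X_sub_C δ)

theorem natDegree_comp_quad (δ : F) (r : F[X]) : (r.comp (quad δ)).natDegree = r.natDegree * 2 := by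
  rw [natDegree_comp, natDegree_quad]

theorem monic_comp_quad {r : F[X]} (hr : r.Monic) (δ : F) : (r.comp (quad δ)).Monic :=
  hr.comp (monic_quad δ) (by simp [natDegree_quad])

theorem comp_quad_ne_zero (δ : F) {r : F[X]} (hr : r ≠ 0) : r.comp (quad δ) ≠ 0 := by
  intro h
  rcases comp_eq_zero_iff.1 h with h | ⟨-, h⟩
  · exact hr h
  · have := congrArg natDegree h
    simp [natDegree_quad] at this

theorem comp_quad_dvd_comp_quad (δ : F) {r s : F[X]} (h : r.comp (quad δ) ∣ s.comp (quad δ)) :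
    r ∣ s := by
  by_cases hr : r = 0
  · subst hr
    rw [zero_comp, zero_dvd_iff] at h
    by_contra hs
    exact comp_quad_ne_zero δ (fun h' => hs (h' ▸ dvd_refl _)) h
  have key : r.comp (quad δ) ∣ (s % r).comp (quad δ) := by
    have h1 : s.comp (quad δ) =
        r.comp (quad δ) * (s / r).comp (quad δ) + (s % r).comp (quad δ) := by
      rw [← mul_comp, ← add_comp, EuclideanDomain.div_add_mod]
    rw [h1] at h
    exact (dvd_add_right (dvd_mul_right _ _)).1 h
  rw [← EuclideanDomain.mod_eq_zero]
  by_contra h0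
  have h1 := natDegree_le_of_dvd key (comp_quad_ne_zero δ h0)
  rw [natDegree_comp_quad, natDegree_comp_quad] at h1
  have h2 := natDegree_lt_natDegree h0 (EuclideanDomain.mod_lt s hr)
  omega

theorem reflect_apply (δ : F) (f : F[X]) : reflect δ f = f.comp (C δ - X) := rfl

theorem reflect_X (δ : F) : reflect δ X = C δ - X := by simp [reflect]

theorem reflect_quad (δ : F) : reflect δ (quad δ) = quad δ := by
  simp [reflect_apply, quad]; ring

theorem reflect_comp_quad (δ : F) (r : F[X]) :
    reflect δ (r.comp (quad δ)) = r.comp (quad δ) := by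
  rw [reflect_apply, comp_assoc, ← reflect_apply, reflect_quad]

theorem reflect_reflect (δ : F) (f : F[X]) : reflect δ (reflect δ f) = f := by
  simp [reflect_apply, comp_assoc]

theorem natDegree_reflect (δ : F) (f : F[X]) : (reflect δ f).natDegree = f.natDegree := by
  have h : (C δ - X : F[X]).natDegree = 1 := by
    rw [← neg_sub, natDegree_neg, natDegree_X_sub_C]
  rw [reflect_apply, natDegree_comp, h, mul_one]

theorem reflect_injective (δ : F) : Function.Injective (reflect δ) :=
  Function.LeftInverse.injective (reflect_reflect δ)

theorem reflect_dvd_reflect (δ : F) {f g : F[X]} : reflect δ f ∣ reflect δ g ↔ f ∣ g := by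
  constructor
  · rintro ⟨k, hk⟩
    refine ⟨reflect δ k, ?_⟩
    rw [← reflect_reflect δ g, hk, map_mul, reflect_reflect]
  · rintro ⟨k, rfl⟩
    exact ⟨reflect δ k, map_mul _ _ _⟩

theorem irreducible_reflect (δ : F) {f : F[X]} (hf : Irreducible f) :
    Irreducible (reflect δ f) := by
  let e : F[X] ≃ₐ[F] F[X] := AlgEquiv.ofAlgHom (reflect δ) (reflect δ)
    (AlgHom.ext (reflect_reflect δ)) (AlgHom.ext (reflect_reflect δ))
  exact (MulEquiv.irreducible_iff (e : F[X] ≃* F[X])).2 hf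

/-- `F[t]` is generated by `1` and `t` as a module over `F[t ^ 2 - δ t]`. -/
theorem exists_eq_comp_quad_add (δ : F) (f : F[X]) :
    ∃ a b : F[X], f = a.comp (quad δ) + b.comp (quad δ) * X := by
  have hmul : ∀ f : F[X], (∃ a b : F[X], f = a.comp (quad δ) + b.comp (quad δ) * X) →
      ∃ a b : F[X], f * X = a.comp (quad δ) + b.comp (quad δ) * X := by
    rintro _ ⟨a, b, rfl⟩
    refine ⟨b * X, a + C δ * b, ?_⟩
    simp only [add_comp, mul_comp, X_comp, C_comp, quad]
    ring
  induction f using Polynomial.induction_on with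
  | C c => exact ⟨C c, 0, by simp⟩
  | add f g hf hg =>
    obtain ⟨a, b, rfl⟩ := hf
    obtain ⟨a', b', rfl⟩ := hg
    exact ⟨a + a', b + b', by simp only [add_comp]; ring⟩
  | monomial n c h =>
    rw [pow_succ, ← mul_assoc]
    exact hmul _ h

theorem reflect_eq_of_eq (δ : F) {f a b : F[X]}
    (h : f = a.comp (quad δ) + b.comp (quad δ) * X) :
    reflect δ f = a.comp (quad δ) + b.comp (quad δ) * (C δ - X) := by
  rw [h, map_add, map_mul, reflect_comp_quad, reflect_comp_quad, reflect_X]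

theorem isCompQuad_mul_reflect (δ : F) (f : F[X]) : IsCompQuad δ (f * reflect δ f) := by
  obtain ⟨a, b, h⟩ := exists_eq_comp_quad_add δ f
  refine ⟨a ^ 2 + C δ * (a * b) - b ^ 2 * X, ?_⟩
  rw [reflect_eq_of_eq δ h, h]
  simp only [add_comp, sub_comp, mul_comp, pow_comp, X_comp, C_comp]
  rw [quad]
  ring

/-- The coefficient on `t` of `f` over `F[t ^ 2 - δ t]` has degree less than `f`, because the two
terms of `f` have degrees of opposite parities. -/
theorem natDegree_comp_quad_lt (δ : F) {f a b : F[X]}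
    (h : f = a.comp (quad δ) + b.comp (quad δ) * X) (hb : b ≠ 0) :
    (b.comp (quad δ)).natDegree < f.natDegree := by
  have h1 : (b.comp (quad δ) * X).natDegree = b.natDegree * 2 + 1 := by
    rw [natDegree_mul_X (comp_quad_ne_zero δ hb), natDegree_comp_quad]
  have h2 := natDegree_comp_quad δ a
  have h3 := natDegree_comp_quad δ b
  rcases lt_or_ge (a.comp (quad δ)).natDegree (b.comp (quad δ) * X).natDegree with h4 | h4
  · rw [h, natDegree_add_eq_right_of_natDegree_lt h4]; omega
  · have h5 : (b.comp (quad δ) * X).natDegree < (a.comp (quad δ)).natDegree := by omega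
    rw [h, natDegree_add_eq_left_of_natDegree_lt h5]; omega

theorem not_dvd_of_eq_comp_quad_add (δ : F) {f a b : F[X]}
    (h : f = a.comp (quad δ) + b.comp (quad δ) * X) (hf : ¬ IsCompQuad δ f) :
    ¬ f ∣ b.comp (quad δ) := by
  have hb : b ≠ 0 := by
    rintro rfl
    exact hf ⟨a, by simpa using h⟩
  intro hd
  exact absurd (natDegree_le_of_dvd hd (comp_quad_ne_zero δ hb))
    (not_le.2 (natDegree_comp_quad_lt δ h hb))

theorem IsCompQuad.of_mul_isUnit {δ : F} {f c : F[X]} (hf : IsCompQuad δ f) (hc : IsUnit c) :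
    IsCompQuad δ (f * c) := by
  obtain ⟨r, rfl⟩ := hf
  obtain ⟨k, -, rfl⟩ := isUnit_iff.1 hc
  exact ⟨r * C k, by simp⟩

theorem isCompQuad_of_associated {δ : F} {f g : F[X]} (hf : IsCompQuad δ f)
    (h : Associated f g) : IsCompQuad δ g := by
  obtain ⟨c, rfl⟩ := h
  exact hf.of_mul_isUnit c.isUnit

theorem IsCompQuad.reflect_eq {δ : F} {f : F[X]} (hf : IsCompQuad δ f) : reflect δ f = f := by
  obtain ⟨r, rfl⟩ := hf
  exact reflect_comp_quad δ r

/-- The irreducible polynomials that ramify over `F[t ^ 2 - δ t]`: those which are associated to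
their reflection without being polynomials in `t ^ 2 - δ t`. -/
structure IsRamified (δ : F) (π : F[X]) : Prop where
  irreducible : Irreducible π
  not_isCompQuad : ¬ IsCompQuad δ π
  dvd_reflect : π ∣ reflect δ π

theorem IsRamified.associated {δ : F} {π : F[X]} (h : IsRamified δ π) :
    Associated π (reflect δ π) :=
  h.irreducible.associated_of_dvd (irreducible_reflect δ h.irreducible) h.dvd_reflect

/-- A polynomial that divides its reflection, and in which every ramified irreducible polynomial
has even multiplicity, is a polynomial in `t ^ 2 - δ t`. -/
theorem isCompQuad_of_dvd_reflect (δ : F) {f : F[X]} (hf0 : f ≠ 0) (hf : f ∣ reflect δ f)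
    (heven : ∀ π, IsRamified δ π → ∀ (i : ℕ) (k : F[X]), f = π ^ (2 * i + 1) * k → π ∣ k) :
    IsCompQuad δ f := by
  induction hn : f.natDegree using Nat.strong_induction_on generalizing f with
  | _ n ih =>
  by_cases hu : IsUnit f
  · obtain ⟨k, -, rfl⟩ := isUnit_iff.1 hu
    exact ⟨C k, by simp⟩
  -- It suffices to split off a factor `N` which is a polynomial in `t ^ 2 - δ t` and in which
  -- every ramified polynomial has multiplicity `0` or `2`.
  have step : ∀ N m : F[X], f = N * m → IsCompQuad δ N → ¬ IsUnit N →
      (∀ ρ, IsRamified δ ρ → ρ ∣ N → ∃ c, IsUnit c ∧ N = ρ ^ 2 * c) → IsCompQuad δ f := by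
    intro N m hfm hN hNu hρ
    have hN0 : N ≠ 0 := by rintro rfl; simp [hfm] at hf0
    have hm0 : m ≠ 0 := by rintro rfl; simp [hfm] at hf0
    have hNd : 0 < N.natDegree := by
      rw [Nat.pos_iff_ne_zero]
      intro h0
      obtain ⟨k, hk⟩ := natDegree_eq_zero.1 h0
      refine hNu (hk ▸ isUnit_C.2 (isUnit_iff_ne_zero.2 ?_))
      rintro rfl
      simp at hk
      exact hN0 hk.symm
    obtain ⟨s, rfl⟩ : IsCompQuad δ m := by
      refine ih m.natDegree ?_ hm0 ?_ ?_ rfl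
      · rw [← hn, hfm, natDegree_mul hN0 hm0]; omega
      · rw [hfm, map_mul, hN.reflect_eq] at hf
        exact (mul_dvd_mul_iff_left hN0).1 hf
      · intro ρ hr i k hk
        by_cases hd : ρ ∣ N
        · obtain ⟨c, hc, hNc⟩ := hρ ρ hr hd
          have := heven ρ hr (i + 1) (c * k) (by rw [hfm, hNc, hk]; ring)
          exact (hr.irreducible.prime.dvd_or_dvd this).resolve_left
            (fun h => hr.irreducible.not_isUnit (isUnit_of_dvd_unit h hc))
        · have := heven ρ hr i (N * k) (by rw [hfm, hk]; ring)
          exact (hr.irreducible.prime.dvd_or_dvd this).resolve_left hd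
    obtain ⟨r, rfl⟩ := hN
    exact ⟨r * s, by rw [hfm, mul_comp]⟩
  obtain ⟨π, hπ, k, hk⟩ := WfDvdMonoid.exists_irreducible_factor hu hf0
  have hσ := irreducible_reflect δ hπ
  -- The factor `N` is `π` if that is a polynomial in `t ^ 2 - δ t`, and otherwise the norm of `π`,
  -- i.e. the product of `π` and its reflection.
  by_cases hQ : IsCompQuad δ π
  · refine step π k hk hQ hπ.not_isUnit fun ρ hr hd => ?_
    exact absurd (isCompQuad_of_associated hQ
      (hr.irreducible.associated_of_dvd hπ hd).symm) hr.not_isCompQuad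
  have hNu : ¬ IsUnit (π * reflect δ π) := fun h => hπ.not_isUnit (isUnit_of_mul_isUnit_left h)
  by_cases hd : π ∣ reflect δ π
  · have hram : IsRamified δ π := ⟨hπ, hQ, hd⟩
    obtain ⟨m, rfl⟩ := heven π hram 0 k (by simpa using hk)
    obtain ⟨c, hc⟩ := hram.associated
    refine step (π * reflect δ π) (↑(c⁻¹) * m) ?_ (isCompQuad_mul_reflect δ π) hNu ?_
    · rw [← hc, hk, show π * (π * (c : F[X])) * (↑(c⁻¹) * m) = π * (π * (c * ↑(c⁻¹)) * m) by ring,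
        Units.mul_inv, mul_one]
    · intro ρ hr hρN
      have h1 : ρ ∣ π := by
        rcases hr.irreducible.prime.dvd_or_dvd hρN with h | h
        · exact h
        · rw [← hc] at h
          exact (Units.dvd_mul_right).1 h
      obtain ⟨d, hd⟩ := hr.irreducible.associated_of_dvd hπ h1
      refine ⟨d ^ 2 * c, (d.isUnit.pow 2).mul c.isUnit, ?_⟩
      rw [← hc, ← hd]; ring
  · have hd' : ¬ reflect δ π ∣ π := by
      intro h
      apply hd
      have := (reflect_dvd_reflect δ).2 h
      rwa [reflect_reflect] at this
    have hff : reflect δ f ∣ f := by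
      have := (reflect_dvd_reflect δ).2 hf
      rwa [reflect_reflect] at this
    have h1 : reflect δ π ∣ π * k := by
      rw [← hk]
      exact ((reflect_dvd_reflect δ).2 ⟨k, hk⟩).trans hff
    obtain ⟨m, rfl⟩ := (hσ.prime.dvd_or_dvd h1).resolve_left hd'
    refine step (π * reflect δ π) m (by rw [hk]; ring) (isCompQuad_mul_reflect δ π) hNu ?_
    intro ρ hr hρN
    exfalso
    have h2 : Associated ρ π := by
      rcases hr.irreducible.prime.dvd_or_dvd hρN with h | h
      · exact hr.irreducible.associated_of_dvd hπ h
      · have h3 : Associated ρ (reflect δ π) := hr.irreducible.associated_of_dvd hσ h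
        have h4 : reflect δ ρ ∣ π := by
          rw [← reflect_dvd_reflect δ, reflect_reflect]; exact h3.dvd
        exact hr.irreducible.associated_of_dvd hπ (hr.dvd_reflect.trans h4)
    apply hd
    exact h2.symm.dvd.trans (hr.dvd_reflect.trans ((reflect_dvd_reflect δ).2 h2.dvd))

end PolynomialsInQuad

/-! ### Balanced endomorphisms -/

section BalancedEndomorphisms

open Module

variable {F V : Type*} [Field F] [AddCommGroup V] [Module F V]

/-- The intrinsic form of the condition that all the invariant factors of `u` are polynomials in
`t ^ 2 - δ t`. The first condition says that the elementary divisors of `u` are stable under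
`t ↦ δ - t`; the second one says that, for a ramified `π`, the exponents of the elementary divisors
that are powers of `π` are even. -/
structure IsBalanced (δ : F) (u : Module.End F V) : Prop where
  finrank_ker : ∀ g : F[X], finrank F (LinearMap.ker (aeval u g)) =
    finrank F (LinearMap.ker (aeval u (reflect δ g)))
  mem_range : ∀ π : F[X], IsRamified δ π → ∀ (i : ℕ) (x : V), aeval u π x = 0 →
    x ∈ LinearMap.range (aeval u (π ^ (2 * i))) → x ∈ LinearMap.range (aeval u (π ^ (2 * i + 1)))

theorem aeval_mul_apply (u : Module.End F V) (f g : F[X]) (x : V) :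
    aeval u (f * g) x = aeval u f (aeval u g x) := by
  rw [map_mul]; rfl

theorem aeval_add_apply (u : Module.End F V) (f g : F[X]) (x : V) :
    aeval u (f + g) x = aeval u f x + aeval u g x := by
  rw [map_add]; rfl

theorem aeval_apply_of_dvd {u : Module.End F V} {f g : F[X]} (h : f ∣ g) {x : V}
    (hx : aeval u f x = 0) : aeval u g x = 0 := by
  obtain ⟨k, rfl⟩ := h
  rw [mul_comm, aeval_mul_apply, hx, map_zero]

theorem aeval_apply_comm (u : Module.End F V) (f g : F[X]) (x : V) :
    aeval u f (aeval u g x) = aeval u g (aeval u f x) := by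
  rw [← aeval_mul_apply, ← aeval_mul_apply, mul_comm]

variable {A : Type*} [Ring A] [Algebra F A]

theorem commute_aeval {a x : A} (h : Commute a x) (r : F[X]) : Commute a (aeval x r) := by
  induction r using Polynomial.induction_on with
  | C c => rw [aeval_C]; exact (Algebra.commutes c a).symm
  | add f g hf hg => rw [map_add]; exact hf.add_right hg
  | monomial n c _ =>
    rw [map_mul, map_pow, aeval_C, aeval_X]
    exact Commute.mul_right (Algebra.commutes c a).symm (h.pow_right _)

theorem commute_aeval_comp_quad {δ : F} {a u w : A} (hw : Commute u w)
    (h : a * u = (algebraMap F A δ - u) * a + w) (r : F[X]) :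
    Commute a (aeval u (r.comp (quad δ))) := by
  rw [aeval_comp]
  apply commute_aeval
  have hq : aeval u (quad δ) = u * u - δ • u := by
    simp [quad, pow_two, Algebra.smul_def]
  have h' : a * u = δ • a - u * a + w := by
    rw [h, sub_mul, Algebra.smul_def]
  rw [hq, Commute, SemiconjBy, mul_sub, ← mul_assoc, mul_smul_comm, h', add_mul, sub_mul,
    mul_assoc u a u, smul_mul_assoc, h', sub_mul, smul_mul_assoc, mul_assoc, ← hw.eq]
  simp only [mul_add, mul_sub, mul_smul_comm]
  module

/-- An element `a` such that `a u = (δ - u) a + w` acts on `F[u]` as a derivation twisted by the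
reflection. -/
theorem mul_aeval_eq {δ : F} {a u w : A} (hw : Commute u w)
    (h : a * u = (algebraMap F A δ - u) * a + w) {f r s : F[X]}
    (hf : f = r.comp (quad δ) + s.comp (quad δ) * X) :
    a * aeval u f = aeval u (reflect δ f) * a + aeval u (s.comp (quad δ)) * w := by
  rw [reflect_eq_of_eq δ hf, hf]
  have h1 := (commute_aeval_comp_quad hw h r).eq
  have h2 := (commute_aeval_comp_quad hw h s).eq
  simp only [map_add, map_mul, map_sub, aeval_X, aeval_C] at *
  rw [mul_add, ← mul_assoc, h1, h2, mul_assoc, h, mul_add, add_mul, mul_assoc,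
    add_assoc]

theorem injective_aeval_of_dvd {u : Module.End F V} {f g : F[X]} (h : f ∣ g)
    (hg : Function.Injective (aeval u g)) : Function.Injective (aeval u f) := by
  rw [injective_iff_map_eq_zero] at hg ⊢
  exact fun x hx => hg x (aeval_apply_of_dvd h hx)

/-- An injective endomorphism that intertwines `u` and `δ - u` embeds the kernel of `g(u)` into that
of `σ(g)(u)`, where `σ` is the reflection. -/
theorem finrank_ker_aeval_eq_of_injective [FiniteDimensional F V] {δ : F}
    {u G : Module.End F V} (hG : Function.Injective G)
    (h : G * u = (algebraMap F (Module.End F V) δ - u) * G) (g : F[X]) :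
    finrank F (LinearMap.ker (aeval u g)) = finrank F (LinearMap.ker (aeval u (reflect δ g))) := by
  have key : ∀ g : F[X], finrank F (LinearMap.ker (aeval u g)) ≤
      finrank F (LinearMap.ker (aeval u (reflect δ g))) := by
    intro g
    obtain ⟨r, s, hrs⟩ := exists_eq_comp_quad_add δ g
    have h1 := mul_aeval_eq (w := (0 : Module.End F V)) (Commute.zero_right u)
      (by rw [h, add_zero]) hrs
    rw [mul_zero, add_zero] at h1
    have h2 : ∀ x ∈ LinearMap.ker (aeval u g), G x ∈ LinearMap.ker (aeval u (reflect δ g)) := by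
      intro x hx
      rw [LinearMap.mem_ker] at hx ⊢
      have := LinearMap.congr_fun h1 x
      simp only [Module.End.mul_apply, hx, map_zero] at this
      exact this.symm
    exact LinearMap.finrank_le_finrank_of_injective (f := G.restrict h2)
      (fun x y hxy => Subtype.ext (hG (congrArg Subtype.val hxy)))
  refine le_antisymm (key g) ?_
  have := key (reflect δ g)
  rwa [reflect_reflect] at this

/-- If `a u = (δ - u) a + w(u)` then, for a ramified `π`, applying `a` to the equation `π(u) x = 0`
expresses `x` as an element of the range of the next odd power of `π(u)`. -/
theorem mem_range_aeval_pow_of_mul_eq {δ : F} {a u : Module.End F V} {w : F[X]}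
    (h : a * u = (algebraMap F (Module.End F V) δ - u) * a + aeval u w) {π : F[X]}
    (hπ : IsRamified δ π) (hw : ¬ π ∣ w) (i : ℕ) (x : V) (hx : aeval u π x = 0)
    (hxi : x ∈ LinearMap.range (aeval u (π ^ (2 * i)))) :
    x ∈ LinearMap.range (aeval u (π ^ (2 * i + 1))) := by
  have hcomm : Commute u (aeval u w) := commute_aeval (Commute.refl u) w
  obtain ⟨r, s, hrs⟩ := exists_eq_comp_quad_add δ π
  have hs := not_dvd_of_eq_comp_quad_add δ hrs hπ.not_isCompQuad
  obtain ⟨n, hn⟩ := isCompQuad_mul_reflect δ π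
  obtain ⟨c, hc⟩ := hπ.associated
  obtain ⟨y, rfl⟩ := hxi
  -- Up to a unit, `π ^ (2 * i)` is the `i`-th power of the norm of `π`, which commutes with `a`.
  set y' : V := aeval u ((↑(c⁻¹) : F[X]) ^ i) y with hy'
  have hx' : aeval u (π ^ (2 * i)) y = aeval u ((n ^ i).comp (quad δ)) y' := by
    have h0 : (c : F[X]) ^ i * (↑(c⁻¹) : F[X]) ^ i = 1 := by
      rw [← mul_pow, Units.mul_inv, one_pow]
    rw [hy', ← aeval_mul_apply, pow_comp, ← hn, ← hc,
      show (π * (π * (c : F[X]))) ^ i * (↑(c⁻¹) : F[X]) ^ i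
        = π ^ (2 * i) * ((c : F[X]) ^ i * (↑(c⁻¹) : F[X]) ^ i) by ring, h0, mul_one]
  have h1 := LinearMap.congr_fun (mul_aeval_eq hcomm h hrs) (aeval u (π ^ (2 * i)) y)
  have h2 := LinearMap.congr_fun (commute_aeval_comp_quad hcomm h (n ^ i)).eq y'
  simp only [Module.End.mul_apply, LinearMap.add_apply] at h1 h2
  rw [hx, map_zero, hx', h2, ← hx', ← hc, pow_comp, ← hn, ← hc, ← aeval_mul_apply,
    ← aeval_mul_apply, show π * (c : F[X]) * (π * (π * (c : F[X]))) ^ i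
      = π ^ (2 * i + 1) * c ^ (i + 1) by ring, aeval_mul_apply] at h1
  obtain ⟨α, β, hαβ⟩ : IsCoprime (s.comp (quad δ) * w) π := by
    refine ((hπ.irreducible.coprime_iff_not_dvd).2 fun h => ?_).symm
    exact (hπ.irreducible.prime.dvd_or_dvd h).elim hs hw
  set x := aeval u (π ^ (2 * i)) y
  have h3 : x = aeval u α (aeval u (s.comp (quad δ) * w) x) := by
    have h4 : aeval u (α * (s.comp (quad δ) * w) + β * π) x = x := by rw [hαβ]; simp
    rw [aeval_add_apply, aeval_mul_apply, aeval_mul_apply u β, hx, map_zero, add_zero] at h4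
    exact h4.symm
  rw [h3, eq_neg_of_add_eq_zero_right h1.symm, map_neg, aeval_apply_comm]
  exact neg_mem ⟨_, rfl⟩

/-- A criterion for balanced endomorphisms that applies to regular differences, where `G` is the
commutator of the two quadratic endomorphisms, and to multiplication by `t` modulo a polynomial in
`t ^ 2 - δ t`, where `G` is the reflection and `a` is the coefficient on `t`. -/
theorem IsBalanced.of_exists [FiniteDimensional F V] {δ : F} {u G a : Module.End F V} {w : F[X]}
    (hG : Function.Injective G) (hGu : G * u = (algebraMap F (Module.End F V) δ - u) * G)
    (ha : a * u = (algebraMap F (Module.End F V) δ - u) * a + aeval u w)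
    (hw : ∀ π, IsRamified δ π → π ∣ w → Function.Injective (aeval u π)) : IsBalanced δ u where
  finrank_ker := finrank_ker_aeval_eq_of_injective hG hGu
  mem_range π hπ i x hx hxi := by
    by_cases hd : π ∣ w
    · have : x = 0 := (injective_iff_map_eq_zero _).1 (hw π hπ hd) x hx
      rw [this]; exact zero_mem _
    · exact mem_range_aeval_pow_of_mul_eq ha hπ hd i x hx hxi

end BalancedEndomorphisms

/-! ### The fundamental polynomial -/

section FundamentalPolynomial

variable {F : Type*} [Field F]

theorem eq_of_natDegree_eq_two {R : Type*} [CommRing R] {p : R[X]} (hp : p.Monic)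
    (hp2 : p.natDegree = 2) : p = X ^ 2 + C (p.coeff 1) * X + C (p.coeff 0) := by
  conv_lhs => rw [hp.as_sum, hp2]
  simp [Finset.sum_range_succ]
  ring

theorem polyTrace_eq {p : F[X]} (hp2 : p.natDegree = 2) : polyTrace p = -p.coeff 1 := by
  simp [polyTrace, hp2]

/-- The polynomial `w` such that `u₁ u = (δ - u) u₁ + w(u)` whenever `u = u₁ - u₂` with
`p(u₁) = q(u₂) = 0`. -/
def shiftPoly (p q : F[X]) : F[X] := X ^ 2 + C (polyTrace q) * X + C (q.coeff 0 - p.coeff 0)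

theorem resultant_of_natDegree_eq_two {R : Type*} [CommRing R] {f g : R[X]}
    (hf2 : f.natDegree = 2) (hg2 : g.natDegree = 2) :
    resultant f g = (f.coeff 2 * g.coeff 0 - f.coeff 0 * g.coeff 2) ^ 2
      - (f.coeff 2 * g.coeff 1 - f.coeff 1 * g.coeff 2)
        * (f.coeff 1 * g.coeff 0 - f.coeff 0 * g.coeff 1) := by
  rw [hf2, hg2, resultant]
  have : sylvester f g 2 2 = !![g.coeff 0, 0, f.coeff 0, 0;
      g.coeff 1, g.coeff 0, f.coeff 1, f.coeff 0;
      g.coeff 2, g.coeff 1, f.coeff 2, f.coeff 1;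
      0, g.coeff 2, 0, f.coeff 2] := by
    ext i j
    fin_cases i <;> fin_cases j <;> simp [sylvester, Fin.addCases]
  rw [this]
  simp [Matrix.det_succ_row_zero (n := 3), Fin.succAbove, Matrix.det_fin_three,
    Fin.sum_univ_succ]
  ring

theorem fundamentalPoly_eq {p q : F[X]} (hp : p.Monic) (hp2 : p.natDegree = 2) (hq : q.Monic)
    (hq2 : q.natDegree = 2) :
    fundamentalPoly p q = shiftPoly p q ^ 2
      - C (polyTrace p) * (2 * X - C (delta p q)) * shiftPoly p q
      + C (p.coeff 0) * (2 * X - C (delta p q)) ^ 2 := by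
  have h1 : (q.map C).comp (X - C X) =
      C 1 * X ^ 2 + C (C (q.coeff 1) - (X + X)) * X +
        C (X ^ 2 - C (q.coeff 1) * X + C (q.coeff 0)) := by
    conv_lhs => rw [eq_of_natDegree_eq_two hq hq2]
    simp
    ring
  have h2 : (p.map C) = C 1 * X ^ 2 + C (C (p.coeff 1)) * X + C (C (p.coeff 0)) := by
    conv_lhs => rw [eq_of_natDegree_eq_two hp hp2]
    simp
  rw [fundamentalPoly, resultant_of_natDegree_eq_two]
  · have h3 : ∀ a b c : F[X], (C a * X ^ 2 + C b * X + C c).coeff 2 = a ∧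
        (C a * X ^ 2 + C b * X + C c).coeff 1 = b ∧ (C a * X ^ 2 + C b * X + C c).coeff 0 = c := by
      intro a b c
      simp [coeff_X, coeff_C, coeff_X_pow]
    rw [h1, h2, shiftPoly, delta, polyTrace_eq hp2, polyTrace_eq hq2]
    simp only [h3]
    simp only [map_sub, map_neg]
    ring
  · rw [h2]; exact natDegree_quadratic one_ne_zero
  · rw [h1]; exact natDegree_quadratic one_ne_zero

end FundamentalPolynomial

/-! ### Regular differences are balanced -/

section Differences

variable {F V : Type*} [Field F] [AddCommGroup V] [Module F V]

theorem isRegular_iff {p q : F[X]} [FiniteDimensional F V] {u : Module.End F V} :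
    IsRegular p q u ↔ Function.Injective (aeval u (fundamentalPoly p q)) := by
  rw [IsRegular, regularPart, iInf_eq_top]
  constructor
  · intro h
    have := h 1
    rw [pow_one, LinearMap.range_eq_top] at this
    exact LinearMap.injective_iff_surjective.2 this
  · intro h n
    rw [LinearMap.range_eq_top, ← LinearMap.injective_iff_surjective]
    induction n with
    | zero => exact fun x y h => h
    | succ n ih => rw [pow_succ]; exact ih.comp h

theorem isRegular_iff_finrank_ker [FiniteDimensional F V] {p q : F[X]} {u : Module.End F V} :
    IsRegular p q u ↔ Module.finrank F (LinearMap.ker (aeval u (fundamentalPoly p q))) = 0 := by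
  rw [isRegular_iff, Submodule.finrank_eq_zero, ← LinearMap.ker_eq_bot]

/-- For `u = a - b`, the element `g` is the commutator `a b - b a`; it intertwines `u` and `δ - u`,
and its square is `F_{p,q}(u)`. -/
theorem exists_mul_self_eq_aeval_fundamentalPoly {A : Type*} [Ring A] [Algebra F A] {p q : F[X]}
    (hp : p.Monic) (hp2 : p.natDegree = 2) (hq : q.Monic) (hq2 : q.natDegree = 2) {a b : A}
    (ha : aeval a p = 0) (hb : aeval b q = 0) :
    a * (a - b) = (algebraMap F A (delta p q) - (a - b)) * a + aeval (a - b) (shiftPoly p q) ∧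
    ∃ g : A, g * (a - b) = (algebraMap F A (delta p q) - (a - b)) * g ∧
      g * g = aeval (a - b) (fundamentalPoly p q) := by
  have ha' : a * a = polyTrace p • a - p.coeff 0 • 1 := by
    rw [eq_of_natDegree_eq_two hp hp2] at ha
    simp only [map_add, map_mul, map_pow, aeval_X, aeval_C, ← Algebra.smul_def] at ha
    rw [polyTrace_eq hp2, ← pow_two, eq_sub_iff_add_eq, ← sub_eq_zero, ← ha,
      Algebra.algebraMap_eq_smul_one]
    module
  have hb' : b * b = polyTrace q • b - q.coeff 0 • 1 := by
    rw [eq_of_natDegree_eq_two hq hq2] at hb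
    simp only [map_add, map_mul, map_pow, aeval_X, aeval_C, ← Algebra.smul_def] at hb
    rw [polyTrace_eq hq2, ← pow_two, eq_sub_iff_add_eq, ← sub_eq_zero, ← hb,
      Algebra.algebraMap_eq_smul_one]
    module
  have h1 : a * (a - b) = (algebraMap F A (delta p q) - (a - b)) * a
      + aeval (a - b) (shiftPoly p q) := by
    simp only [shiftPoly, delta, map_add, map_mul, aeval_X, aeval_C,
      Algebra.algebraMap_eq_smul_one, pow_two, mul_sub, sub_mul, smul_mul_assoc, one_mul, ha', hb']
    module
  refine ⟨h1, ?_⟩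
  generalize a - b = u at *
  set E : A := aeval u (2 * X - C (delta p q)) with hE
  set W : A := aeval u (shiftPoly p q) with hW
  have hcomm : Commute u W := commute_aeval (Commute.refl u) _
  have hEW : E * W = W * E := by rw [hE, hW, ← map_mul, ← map_mul, mul_comm]
  have hE' : E = u + u - algebraMap F A (delta p q) := by
    rw [hE, two_mul]; simp
  have haE : a * E = 2 • W - E * a := by
    rw [hE', mul_sub, mul_add, h1, ← Algebra.commutes]
    noncomm_ring
  have haW : a * W = W * a - polyTrace p • (E * a) + polyTrace p • W := by
    have h2 : shiftPoly p q = (X + C (q.coeff 0 - p.coeff 0)).comp (quad (delta p q))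
        + (C (polyTrace p)).comp (quad (delta p q)) * X := by
      simp [shiftPoly, quad, delta]; ring
    have h3 := mul_aeval_eq hcomm h1 h2
    have h4 : reflect (delta p q) (shiftPoly p q)
        = shiftPoly p q - C (polyTrace p) * (2 * X - C (delta p q)) := by
      rw [reflect_eq_of_eq _ h2, h2]; simp; ring
    rw [h3, h4, map_sub, map_mul, ← hE, ← hW, aeval_C, C_comp, aeval_C, sub_mul]
    simp only [Algebra.algebraMap_eq_smul_one, smul_mul_assoc, one_mul]
  -- `E * a - W` is `u * a - a * u = a * b - b * a`, written in terms of `u` and `a` only.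
  refine ⟨E * a - W, ?_, ?_⟩
  · rw [sub_mul, mul_sub, mul_assoc, h1, ← hcomm.eq, hE']
    simp only [mul_add, mul_sub, add_mul, sub_mul, Algebra.algebraMap_eq_smul_one, smul_mul_assoc,
      one_mul, mul_smul_comm]
    module
  · rw [fundamentalPoly_eq hp hp2 hq hq2]
    have h5 : (E * a - W) * (E * a - W)
        = E * (a * E) * a - E * (a * W) - W * E * a + W * W := by noncomm_ring
    have h6 : E * (2 • W - E * a) * a = 2 • (E * W * a) - E * E * (a * a) := by noncomm_ring
    have h7 : aeval u (shiftPoly p q ^ 2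
        - C (polyTrace p) * (2 * X - C (delta p q)) * shiftPoly p q
        + C (p.coeff 0) * (2 * X - C (delta p q)) ^ 2)
        = W * W - polyTrace p • (E * W) + p.coeff 0 • (E * E) := by
      rw [map_add, map_sub, map_mul, map_mul, map_mul, map_pow, map_pow, aeval_C, aeval_C, ← hE,
        ← hW, ← Algebra.smul_def, ← Algebra.smul_def, pow_two, pow_two, smul_mul_assoc]
    rw [h5, haE, haW, h6, h7, ha', ← hEW]
    simp only [mul_add, mul_sub, mul_smul_comm, mul_one, ← mul_assoc]
    module

/-- The two quadratic endomorphisms need not be alternating here. -/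
theorem isBalanced_of_isDifference [FiniteDimensional F V] {p q : F[X]}
    (hp : p.Monic) (hp2 : p.natDegree = 2) (hq : q.Monic) (hq2 : q.natDegree = 2)
    {s : SymplecticPair F V} (hreg : IsRegular p q s.endo) (hs : s.IsDifference p q) :
    IsBalanced (delta p q) s.endo := by
  obtain ⟨a, b, -, -, ha, hb, hab⟩ := hs
  rw [isRegular_iff] at hreg
  obtain ⟨h1, g, hg, hgg⟩ := exists_mul_self_eq_aeval_fundamentalPoly hp hp2 hq hq2 ha hb
  rw [← hab] at h1 hg hgg
  refine IsBalanced.of_exists (G := g) ?_ hg h1 ?_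
  · rw [← hgg] at hreg
    exact Function.Injective.of_comp (f := g) hreg
  · intro π hπ hd
    refine injective_aeval_of_dvd ?_ hreg
    -- A ramified `π` divides `2 t - δ`; were it to divide `w`, it would divide `F_{p,q}`.
    have hE : π ∣ 2 * X - C (delta p q) := by
      obtain ⟨r, t, h⟩ := exists_eq_comp_quad_add (delta p q) π
      have h2 : π ∣ t.comp (quad (delta p q)) * (2 * X - C (delta p q)) := by
        have h3 := dvd_sub (dvd_refl π) hπ.dvd_reflect
        rw [reflect_eq_of_eq _ h] at h3
        nth_rewrite 2 [h] at h3
        convert h3 using 1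
        ring
      exact (hπ.irreducible.prime.dvd_or_dvd h2).resolve_left
        (not_dvd_of_eq_comp_quad_add _ h hπ.not_isCompQuad)
    rw [fundamentalPoly_eq hp hp2 hq hq2]
    exact dvd_add (dvd_sub (dvd_pow hd two_ne_zero) (hd.mul_left _))
      ((dvd_pow hE two_ne_zero).mul_left _)

/-- The roots of `F_{p,q}` are the differences of a root of `p` and a root of `q`. -/
theorem isCoprime_fundamentalPoly_iff {p q : F[X]}
    (hp : p.Monic) (hp2 : p.natDegree = 2) (hq : q.Monic) (hq2 : q.natDegree = 2) (f : F[X]) :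
    IsCoprime (fundamentalPoly p q) f ↔
      ∀ x ∈ p.rootSet (AlgebraicClosure F), ∀ y ∈ q.rootSet (AlgebraicClosure F),
        aeval (x - y) f ≠ 0 := by
  let K := AlgebraicClosure F
  have split : ∀ p : F[X], p.Monic → p.natDegree = 2 → ∃ x₁ x₂ : K,
      algebraMap F K (p.coeff 1) = -(x₁ + x₂) ∧ algebraMap F K (p.coeff 0) = x₁ * x₂ := by
    intro p hp hp2
    have hm : (p.map (algebraMap F K)).Monic := hp.map _
    have hd : (p.map (algebraMap F K)).natDegree = 2 := by rw [natDegree_map, hp2]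
    obtain ⟨x₁, h₁⟩ := IsAlgClosed.exists_root (p.map (algebraMap F K))
      (by rw [degree_eq_natDegree hm.ne_zero, hd]; norm_num)
    rw [IsRoot, eq_of_natDegree_eq_two hm hd] at h₁
    simp only [coeff_map, eval_add, eval_pow, eval_X, eval_mul, eval_C] at h₁
    refine ⟨x₁, -algebraMap F K (p.coeff 1) - x₁, by ring, ?_⟩
    linear_combination h₁
  have hev : ∀ (p : F[X]), p.Monic → p.natDegree = 2 → ∀ (x₁ x₂ z : K),
      algebraMap F K (p.coeff 1) = -(x₁ + x₂) → algebraMap F K (p.coeff 0) = x₁ * x₂ →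
      aeval z p = (z - x₁) * (z - x₂) := by
    intro p hp hp2 x₁ x₂ z h1 h0
    rw [eq_of_natDegree_eq_two hp hp2]
    simp only [map_add, map_mul, map_pow, aeval_X, aeval_C, h1, h0]
    ring
  obtain ⟨x₁, x₂, hx1, hx0⟩ := split p hp hp2
  obtain ⟨y₁, y₂, hy1, hy0⟩ := split q hq hq2
  have hF : ∀ z : K, aeval z (fundamentalPoly p q) =
      ((x₁ - y₁ - z) * (x₁ - y₂ - z)) * ((x₂ - y₁ - z) * (x₂ - y₂ - z)) := by
    intro z
    rw [fundamentalPoly_eq hp hp2 hq hq2, shiftPoly, delta, polyTrace_eq hp2, polyTrace_eq hq2]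
    simp only [map_add, map_sub, map_mul, map_pow, map_neg, aeval_X, aeval_C, hx1, hx0, hy1, hy0,
      map_ofNat]
    ring
  refine (isCoprime_iff_aeval_ne_zero_of_isAlgClosed F K _ _).trans ?_
  constructor
  · intro h x hx y hy
    refine (h (x - y)).resolve_left (not_not.2 ?_)
    have hx' : aeval x p = 0 := (mem_rootSet.1 hx).2
    have hy' : aeval y q = 0 := (mem_rootSet.1 hy).2
    rw [hev p hp hp2 x₁ x₂ x hx1 hx0] at hx'
    rw [hev q hq hq2 y₁ y₂ y hy1 hy0] at hy'
    rw [hF]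
    rcases mul_eq_zero.1 hx' with hx' | hx' <;> rcases mul_eq_zero.1 hy' with hy' | hy' <;>
      rw [sub_eq_zero] at hx' hy' <;> subst hx' hy' <;> simp
  · intro h z
    by_cases hz : aeval z (fundamentalPoly p q) = 0
    · right
      have hx : ∀ x, x = x₁ ∨ x = x₂ → x ∈ p.rootSet K := by
        intro x hx
        rw [mem_rootSet, hev p hp hp2 x₁ x₂ x hx1 hx0]
        refine ⟨hp.ne_zero, ?_⟩
        rcases hx with rfl | rfl <;> simp
      have hy : ∀ y, y = y₁ ∨ y = y₂ → y ∈ q.rootSet K := by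
        intro y hy
        rw [mem_rootSet, hev q hq hq2 y₁ y₂ y hy1 hy0]
        refine ⟨hq.ne_zero, ?_⟩
        rcases hy with rfl | rfl <;> simp
      rw [hF] at hz
      simp only [mul_eq_zero, or_assoc] at hz
      rcases hz with hz | hz | hz | hz <;> rw [← sub_eq_zero.1 hz]
      · exact h _ (hx _ (Or.inl rfl)) _ (hy _ (Or.inl rfl))
      · exact h _ (hx _ (Or.inl rfl)) _ (hy _ (Or.inr rfl))
      · exact h _ (hx _ (Or.inr rfl)) _ (hy _ (Or.inl rfl))
      · exact h _ (hx _ (Or.inr rfl)) _ (hy _ (Or.inr rfl))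
    · exact Or.inl hz

end Differences

/-! ### Cyclic endomorphisms -/

section CyclicVectors

open Module

variable {F L V W : Type*} [Field F] [AddCommGroup L] [Module F L] [AddCommGroup V] [Module F V]
  [AddCommGroup W] [Module F W]

/-- A linear map intertwining `u` and `w` intertwines `g(u)` and `g(w)`. -/
theorem map_aeval_apply {u : Module.End F V} {w : Module.End F W} {φ : V →ₗ[F] W}
    (h : ∀ x, φ (u x) = w (φ x)) (g : F[X]) (x : V) :
    φ (aeval u g x) = aeval w g (φ x) := by
  induction g using Polynomial.induction_on generalizing x with
  | C c => simp [Algebra.algebraMap_eq_smul_one]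
  | add f g hf hg => rw [aeval_add_apply, aeval_add_apply, map_add, hf, hg]
  | monomial n c ih =>
    rw [pow_succ, ← mul_assoc, aeval_mul_apply u _ X, aeval_mul_apply w _ X, aeval_X, aeval_X,
      ih, h]

theorem aeval_dualMap_apply (v : Module.End F V) (g : F[X]) (φ : Module.Dual F V) (x : V) :
    aeval v.dualMap g φ x = φ (aeval v g x) := by
  induction g using Polynomial.induction_on generalizing φ with
  | C c => simp [Algebra.algebraMap_eq_smul_one]
  | add f g hf hg => rw [aeval_add_apply, aeval_add_apply, map_add, LinearMap.add_apply, hf, hg]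
  | monomial n c ih =>
    rw [pow_succ, ← mul_assoc, aeval_mul_apply _ _ X, aeval_X, ih, LinearMap.dualMap_apply,
      mul_comm _ X, aeval_mul_apply v X, aeval_X]

/-- The map `g ↦ g(u) x`. -/
def evalAt (u : Module.End F V) (x : V) : F[X] →ₗ[F] V :=
  (LinearMap.applyₗ x).comp (aeval u).toLinearMap

@[simp]
theorem evalAt_apply (u : Module.End F V) (x : V) (g : F[X]) : evalAt u x g = aeval u g x := rfl

/-- The annihilator of the vector `x` with respect to `u` is generated by `h`. -/
def HasOrder (u : Module.End F V) (x : V) (h : F[X]) : Prop :=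
  ∀ g : F[X], aeval u g x = 0 ↔ h ∣ g

/-- The vector `e` is cyclic for `c`, and its annihilator is generated by `h`: the vector space
`L`, seen as an `F[t]`-module, is isomorphic to `F[t] / (h)`, with `e` corresponding to `1`. -/
structure IsCyclicVector (c : Module.End F L) (e : L) (h : F[X]) : Prop where
  exists_eq : ∀ l, ∃ g : F[X], aeval c g e = l
  hasOrder : HasOrder c e h

theorem HasOrder.aeval_self {u : Module.End F V} {x : V} {h : F[X]} (hx : HasOrder u x h) :
    aeval u h x = 0 := (hx h).2 dvd_rfl

theorem HasOrder.finrank_range {u : Module.End F V} {x : V} {h : F[X]} (hx : HasOrder u x h) :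
    finrank F (LinearMap.range (evalAt u x)) = h.natDegree := by
  have h1 : LinearMap.ker (evalAt u x) = (Ideal.span {h}).restrictScalars F := by
    ext g
    rw [LinearMap.mem_ker, evalAt_apply, hx g, Submodule.restrictScalars_mem,
      Ideal.mem_span_singleton]
  rw [← (evalAt u x).quotKerEquivRange.finrank_eq, h1]
  exact finrank_quotient_span_eq_natDegree

theorem IsCyclicVector.finrank_eq {c : Module.End F L} {e : L} {h : F[X]}
    (hc : IsCyclicVector c e h) : finrank F L = h.natDegree := by
  rw [← hc.hasOrder.finrank_range, (LinearMap.range_eq_top (f := evalAt c e)).2 hc.exists_eq,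
    finrank_top]

theorem IsCyclicVector.aeval_apply_eq_zero {c : Module.End F L} {e : L} {h : F[X]}
    (hc : IsCyclicVector c e h) (l : L) : aeval c h l = 0 := by
  obtain ⟨g, rfl⟩ := hc.exists_eq l
  rw [aeval_apply_comm, hc.hasOrder.aeval_self, map_zero]

theorem IsCyclicVector.aeval_eq_zero_iff {c : Module.End F L} {e : L} {h : F[X]}
    (hc : IsCyclicVector c e h) (g : F[X]) : (∀ l, aeval c g l = 0) ↔ h ∣ g :=
  ⟨fun hg => (hc.hasOrder g).1 (hg e), fun hg l => aeval_apply_of_dvd hg (hc.aeval_apply_eq_zero l)⟩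

theorem IsCyclicVector.exists_linearMap {c : Module.End F L} {e : L} {h : F[X]}
    (hc : IsCyclicVector c e h) (f : F[X] →ₗ[F] W) (hf : ∀ k, f (h * k) = 0) :
    ∃ ι : L →ₗ[F] W, ∀ g : F[X], ι (aeval c g e) = f g := by
  have hker : LinearMap.ker (evalAt c e) ≤ LinearMap.ker f := by
    intro g hg
    obtain ⟨k, rfl⟩ := (hc.hasOrder g).1 hg
    exact hf k
  refine ⟨(LinearMap.ker (evalAt c e)).liftQ f hker ∘ₗ
    ((evalAt c e).quotKerEquivOfSurjective hc.exists_eq).symm.toLinearMap, fun g => ?_⟩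
  have : ((evalAt c e).quotKerEquivOfSurjective hc.exists_eq).symm (evalAt c e g)
      = Submodule.Quotient.mk g := by
    rw [LinearEquiv.symm_apply_eq]; rfl
  rw [← evalAt_apply, LinearMap.comp_apply, LinearEquiv.coe_coe, this]
  rfl

/-- The universal property of a cyclic endomorphism. -/
theorem IsCyclicVector.exists_lift {c : Module.End F L} {e : L} {h : F[X]}
    (hc : IsCyclicVector c e h) {w : Module.End F W} {y : W} (hy : aeval w h y = 0) :
    ∃ ι : L →ₗ[F] W, (∀ g : F[X], ι (aeval c g e) = aeval w g y) ∧ ∀ l, ι (c l) = w (ι l) := by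
  obtain ⟨ι, hι⟩ := hc.exists_linearMap (evalAt w y)
    (fun k => by rw [evalAt_apply, mul_comm, aeval_mul_apply, hy, map_zero])
  refine ⟨ι, hι, fun l => ?_⟩
  obtain ⟨g, rfl⟩ := hc.exists_eq l
  have h1 := hι (X * g)
  rw [aeval_mul_apply, aeval_X, evalAt_apply, aeval_mul_apply, aeval_X] at h1
  rw [h1, hι, evalAt_apply]

theorem IsCyclicVector.injective_of_hasOrder {c : Module.End F L} {e : L} {h : F[X]}
    (hc : IsCyclicVector c e h) {w : Module.End F W} {y : W} (hy : HasOrder w y h)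
    {ι : L →ₗ[F] W} (hι : ∀ g : F[X], ι (aeval c g e) = aeval w g y) : Function.Injective ι := by
  rw [injective_iff_map_eq_zero]
  intro l hl
  obtain ⟨g, rfl⟩ := hc.exists_eq l
  rw [hι, hy] at hl
  exact (hc.hasOrder g).2 hl

theorem IsCyclicVector.exists_equiv {c : Module.End F L} {e : L} {h : F[X]}
    (hc : IsCyclicVector c e h) {w : Module.End F W} {y : W} (hw : IsCyclicVector w y h) :
    ∃ φ : L ≃ₗ[F] W, ∀ l, φ (c l) = w (φ l) := by
  obtain ⟨ι, h1, h2⟩ := hc.exists_lift hw.hasOrder.aeval_self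
  refine ⟨LinearEquiv.ofBijective ι ⟨hc.injective_of_hasOrder hw.hasOrder h1, fun z => ?_⟩, h2⟩
  obtain ⟨g, rfl⟩ := hw.exists_eq z
  exact ⟨_, h1 g⟩

/-- The Frobenius form of a cyclic endomorphism: a linear form whose kernel contains no nonzero
invariant subspace. -/
theorem IsCyclicVector.exists_dual {c : Module.End F L} {e : L} {h : F[X]}
    (hc : IsCyclicVector c e h) (hh : h.Monic) :
    ∃ ℓ : Module.Dual F L, ∀ l, (∀ g : F[X], ℓ (aeval c g l) = 0) → l = 0 := by
  -- the coefficient on `t ^ (deg h - 1)` of the remainder modulo `h`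
  obtain ⟨ℓ, hℓ⟩ := hc.exists_linearMap
    (((lcoeff F (h.natDegree - 1)).comp (modByMonicHom h)))
    (fun k => by simp [modByMonicHom, (modByMonic_eq_zero_iff_dvd hh).2 (dvd_mul_right h k)])
  refine ⟨ℓ, fun l hl => ?_⟩
  obtain ⟨g, rfl⟩ := hc.exists_eq l
  rw [hc.hasOrder g, ← modByMonic_eq_zero_iff_dvd hh]
  by_contra h0
  set r := g %ₘ h with hr
  have hdeg : r.natDegree < h.natDegree := by
    refine natDegree_modByMonic_lt g hh ?_
    rintro rfl
    simp at hr
    exact h0 hr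
  have h1 := hl (X ^ (h.natDegree - 1 - r.natDegree))
  rw [← aeval_mul_apply, hℓ] at h1
  have h2 : (X ^ (h.natDegree - 1 - r.natDegree) * g) %ₘ h
      = X ^ (h.natDegree - 1 - r.natDegree) * r := by
    rw [← modByMonic_eq_self_iff hh |>.2
      (?_ : degree (X ^ (h.natDegree - 1 - r.natDegree) * r) < _)]
    · rw [← sub_eq_zero, ← sub_modByMonic, ← mul_sub, modByMonic_eq_zero_iff_dvd hh, hr]
      exact (dvd_sub_comm.1 (modByMonic_eq_sub_mul_div g h ▸ by simp)).mul_left _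
    · rw [degree_eq_natDegree hh.ne_zero]
      refine (natDegree_lt_iff_degree_lt (mul_ne_zero (pow_ne_zero _ X_ne_zero) h0)).1 ?_
      rw [natDegree_mul (pow_ne_zero _ X_ne_zero) h0, natDegree_X_pow]
      omega
  have h3 : (X ^ (h.natDegree - 1 - r.natDegree) * r).coeff (h.natDegree - 1) = r.leadingCoeff := by
    conv_lhs => rw [show h.natDegree - 1 = r.natDegree + (h.natDegree - 1 - r.natDegree) by omega]
    rw [show r.natDegree + (h.natDegree - 1 - r.natDegree) - r.natDegree
      = h.natDegree - 1 - r.natDegree by omega, coeff_X_pow_mul, leadingCoeff]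
  simp only [LinearMap.comp_apply, modByMonicHom, LinearMap.coe_mk, AddHom.coe_mk, lcoeff_apply,
    h2, h3] at h1
  exact h0 (leadingCoeff_eq_zero.1 h1)

open scoped Classical in
theorem IsCyclicVector.finrank_ker_aeval {c : Module.End F L} {e : L} {h : F[X]}
    (hc : IsCyclicVector c e h) (hh : h ≠ 0) (g : F[X]) :
    finrank F (LinearMap.ker (aeval c g)) = (EuclideanDomain.gcd g h).natDegree := by
  obtain ⟨g₁, hg₁⟩ := EuclideanDomain.gcd_dvd_left g h
  obtain ⟨h₁, hh₁⟩ := EuclideanDomain.gcd_dvd_right g h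
  set d := EuclideanDomain.gcd g h with hd
  have hd0 : d ≠ 0 := by rintro h0; rw [h0, zero_mul] at hh₁; exact hh hh₁
  have h10 : h₁ ≠ 0 := by rintro h0; rw [h0, mul_zero] at hh₁; exact hh hh₁
  have hcop : IsCoprime h₁ g₁ := by
    refine ⟨EuclideanDomain.gcdB g h, EuclideanDomain.gcdA g h, mul_left_cancel₀ hd0 ?_⟩
    have := EuclideanDomain.gcd_eq_gcd_ab g h
    rw [← hd] at this
    linear_combination -this - EuclideanDomain.gcdB g h * hh₁ - EuclideanDomain.gcdA g h * hg₁
  have hord : HasOrder c (aeval c h₁ e) d := by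
    intro k
    rw [← aeval_mul_apply, hc.hasOrder, hh₁, mul_dvd_mul_iff_right h10]
  suffices hk : LinearMap.ker (aeval c g) = LinearMap.range (evalAt c (aeval c h₁ e)) by
    rw [hk, hord.finrank_range]
  ext l
  rw [LinearMap.mem_ker, LinearMap.mem_range]
  constructor
  · intro hl
    obtain ⟨k, rfl⟩ := hc.exists_eq l
    rw [← aeval_mul_apply, hc.hasOrder, hh₁, hg₁, mul_assoc, mul_dvd_mul_iff_left hd0] at hl
    obtain ⟨m, rfl⟩ := hcop.dvd_of_dvd_mul_left hl
    exact ⟨m, by rw [evalAt_apply, ← aeval_mul_apply, mul_comm]⟩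
  · rintro ⟨k, rfl⟩
    rw [evalAt_apply, ← aeval_mul_apply, ← aeval_mul_apply, hc.hasOrder]
    exact ⟨g₁ * k, by linear_combination (k * h₁) * hg₁ - (g₁ * k) * hh₁⟩

end CyclicVectors

/-! ### Direct sums and transposes of balanced endomorphisms -/

section BalancedSums

open Module

variable {F V W : Type*} [Field F] [AddCommGroup V] [Module F V] [AddCommGroup W] [Module F W]

theorem finrank_ker_aeval_congr {u : Module.End F V} {w : Module.End F W} (φ : V ≃ₗ[F] W)
    (h : ∀ x, φ (u x) = w (φ x)) (g : F[X]) :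
    finrank F (LinearMap.ker (aeval u g)) = finrank F (LinearMap.ker (aeval w g)) := by
  have h1 : LinearMap.ker (aeval w g) = (LinearMap.ker (aeval u g)).map (φ : V →ₗ[F] W) := by
    ext y
    obtain ⟨x, rfl⟩ := φ.surjective y
    have h2 : φ (aeval u g x) = aeval w g (φ x) := map_aeval_apply (φ := (φ : V →ₗ[F] W)) h g x
    simp [← h2]
  rw [h1, LinearEquiv.finrank_map_eq]

theorem IsBalanced.congr {δ : F} {u : Module.End F V} {w : Module.End F W} (hu : IsBalanced δ u)
    (φ : V ≃ₗ[F] W) (h : ∀ x, φ (u x) = w (φ x)) : IsBalanced δ w where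
  finrank_ker g := by
    rw [← finrank_ker_aeval_congr φ h, ← finrank_ker_aeval_congr φ h, hu.finrank_ker]
  mem_range π hπ i y := by
    have h2 : ∀ g x, φ (aeval u g x) = aeval w g (φ x) :=
      map_aeval_apply (φ := (φ : V →ₗ[F] W)) h
    rintro hy ⟨z, rfl⟩
    obtain ⟨z, rfl⟩ := φ.surjective z
    rw [← h2, ← h2, LinearEquiv.map_eq_zero_iff] at hy
    obtain ⟨t, ht⟩ := hu.mem_range π hπ i _ hy ⟨z, rfl⟩
    exact ⟨φ t, by rw [← h2, ← h2, ht]⟩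

theorem aeval_prodMap_apply (u : Module.End F V) (w : Module.End F W) (g : F[X]) (z : V × W) :
    aeval (u.prodMap w : Module.End F (V × W)) g z = (aeval u g z.1, aeval w g z.2) :=
  Prod.ext (map_aeval_apply (u := u.prodMap w) (φ := LinearMap.fst F V W) (fun _ => rfl) g z)
    (map_aeval_apply (u := u.prodMap w) (φ := LinearMap.snd F V W) (fun _ => rfl) g z)

theorem IsBalanced.mem_range_snd {δ : F} {u : Module.End F V} {w : Module.End F W}
    (h : IsBalanced δ (u.prodMap w : Module.End F (V × W))) (π : F[X]) (hπ : IsRamified δ π) (i : ℕ)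
    (x : W) (hx : aeval w π x = 0) (hxi : x ∈ LinearMap.range (aeval w (π ^ (2 * i)))) :
    x ∈ LinearMap.range (aeval w (π ^ (2 * i + 1))) := by
  obtain ⟨y, rfl⟩ := hxi
  obtain ⟨t, ht⟩ := h.mem_range π hπ i (0, aeval w (π ^ (2 * i)) y)
    (by rw [aeval_prodMap_apply]; exact Prod.ext (map_zero _) hx)
    ⟨(0, y), by rw [aeval_prodMap_apply]; exact Prod.ext (map_zero _) rfl⟩
  rw [aeval_prodMap_apply] at ht
  exact ⟨t.2, congrArg Prod.snd ht⟩

/-- Under the second condition of `IsBalanced`, the generator of the annihilator of the whole space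
is a polynomial in `t ^ 2 - δ t` as soon as it divides its reflection: if it is `π ^ (2 i + 1) k`
with `π` ramified, then `π ^ (2 i) k ^ 2` annihilates the space as well, so that `π` divides `k`. -/
theorem isCompQuad_of_annihilator {δ : F} {u : Module.End F V} {h : F[X]} (hh0 : h ≠ 0)
    (hh : ∀ g : F[X], (∀ x, aeval u g x = 0) ↔ h ∣ g) (hσ : h ∣ reflect δ h)
    (hu : ∀ π : F[X], IsRamified δ π → ∀ (i : ℕ) (x : V), aeval u π x = 0 →
      x ∈ LinearMap.range (aeval u (π ^ (2 * i))) →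
        x ∈ LinearMap.range (aeval u (π ^ (2 * i + 1)))) : IsCompQuad δ h := by
  refine isCompQuad_of_dvd_reflect δ hh0 hσ fun π hπ i k hk => ?_
  have h1 : h ∣ π ^ (2 * i) * (k * k) := by
    refine (hh _).1 fun x => ?_
    obtain ⟨y, hy⟩ := hu π hπ i (aeval u (π ^ (2 * i)) (aeval u k x))
      (by
        rw [← aeval_mul_apply, ← aeval_mul_apply, ← pow_succ', ← hk]
        exact (hh h).2 dvd_rfl x) ⟨_, rfl⟩
    rw [← mul_assoc, mul_comm _ k, aeval_mul_apply, aeval_mul_apply, ← hy, ← aeval_mul_apply,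
      mul_comm, ← hk]
    exact (hh h).2 dvd_rfl y
  have hπ0 := hπ.irreducible.ne_zero
  have hk0 : k ≠ 0 := by rintro rfl; simp [hk] at hh0
  rw [hk, pow_succ, mul_assoc, mul_dvd_mul_iff_left (pow_ne_zero _ hπ0),
    mul_dvd_mul_iff_right hk0] at h1
  exact h1

variable {ι : Type*} {M : ι → Type*} [∀ i, AddCommGroup (M i)] [∀ i, Module F (M i)]

/-- The direct sum of a family of endomorphisms. -/
def piMap (u : ∀ i, Module.End F (M i)) : Module.End F (∀ i, M i) :=
  LinearMap.pi fun i => (u i).comp (LinearMap.proj i)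

theorem aeval_piMap_apply (u : ∀ i, Module.End F (M i)) (g : F[X]) (z : ∀ i, M i) (i : ι) :
    aeval (piMap u) g z i = aeval (u i) g (z i) :=
  map_aeval_apply (u := piMap u) (φ := LinearMap.proj i) (fun _ => rfl) g z

variable [FiniteDimensional F V] [FiniteDimensional F W]

theorem finrank_ker_aeval_prodMap (u : Module.End F V) (w : Module.End F W) (g : F[X]) :
    finrank F (LinearMap.ker (aeval (u.prodMap w : Module.End F (V × W)) g)) =
      finrank F (LinearMap.ker (aeval u g)) + finrank F (LinearMap.ker (aeval w g)) := by
  rw [← finrank_prod]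
  refine LinearEquiv.finrank_eq
    { toFun := fun z => (⟨z.1.1, ?_⟩, ⟨z.1.2, ?_⟩)
      invFun := fun z => ⟨(z.1.1, z.2.1), ?_⟩
      map_add' := fun _ _ => rfl
      map_smul' := fun _ _ => rfl
      left_inv := fun _ => rfl
      right_inv := fun _ => rfl }
  · have := z.2
    rw [LinearMap.mem_ker, aeval_prodMap_apply] at this
    exact congrArg Prod.fst this
  · have := z.2
    rw [LinearMap.mem_ker, aeval_prodMap_apply] at this
    exact congrArg Prod.snd this
  · rw [LinearMap.mem_ker, aeval_prodMap_apply]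
    exact Prod.ext z.1.2 z.2.2

theorem IsBalanced.prodMap {δ : F} {u : Module.End F V} {w : Module.End F W} (hu : IsBalanced δ u)
    (hw : IsBalanced δ w) : IsBalanced δ (u.prodMap w : Module.End F (V × W)) where
  finrank_ker g := by
    rw [finrank_ker_aeval_prodMap, finrank_ker_aeval_prodMap, hu.finrank_ker, hw.finrank_ker]
  mem_range π hπ i z := by
    rintro hz ⟨y, rfl⟩
    simp only [aeval_prodMap_apply, Prod.mk_eq_zero] at hz
    obtain ⟨s, hs⟩ := hu.mem_range π hπ i _ hz.1 ⟨_, rfl⟩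
    obtain ⟨t, ht⟩ := hw.mem_range π hπ i _ hz.2 ⟨_, rfl⟩
    exact ⟨(s, t), by rw [aeval_prodMap_apply, aeval_prodMap_apply, hs, ht]⟩

theorem IsBalanced.snd {δ : F} {u : Module.End F V} {w : Module.End F W} (hu : IsBalanced δ u)
    (h : IsBalanced δ (u.prodMap w : Module.End F (V × W))) : IsBalanced δ w where
  finrank_ker g := by
    have := h.finrank_ker g
    rw [finrank_ker_aeval_prodMap, finrank_ker_aeval_prodMap, hu.finrank_ker] at this
    exact Nat.add_left_cancel this
  mem_range := h.mem_range_snd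

theorem finrank_ker_aeval_dualMap (v : Module.End F V) (g : F[X]) :
    finrank F (LinearMap.ker (aeval (v.dualMap : Module.End F (Dual F V)) g)) =
      finrank F (LinearMap.ker (aeval v g)) := by
  have h1 : (aeval (v.dualMap : Module.End F (Dual F V)) g) = (aeval v g).dualMap :=
    LinearMap.ext fun φ => LinearMap.ext fun x => aeval_dualMap_apply v g φ x
  have h2 := LinearMap.finrank_range_add_finrank_ker (aeval v g)
  have h3 := LinearMap.finrank_range_add_finrank_ker (aeval v g).dualMap
  rw [LinearMap.finrank_range_dualMap_eq_finrank_range, Subspace.dual_finrank_eq] at h3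
  rw [h1]
  omega

theorem IsBalanced.dualMap {δ : F} {v : Module.End F V} (hv : IsBalanced δ v) :
    IsBalanced δ (v.dualMap : Module.End F (Dual F V)) where
  finrank_ker g := by rw [finrank_ker_aeval_dualMap, finrank_ker_aeval_dualMap, hv.finrank_ker]
  mem_range π hπ i φ := by
    rintro hφ ⟨ψ, rfl⟩
    have h1 : (aeval (v.dualMap : Module.End F (Dual F V)) (π ^ (2 * i + 1)))
        = (aeval v (π ^ (2 * i + 1))).dualMap :=
      LinearMap.ext fun φ => LinearMap.ext fun x => aeval_dualMap_apply v _ φ x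
    rw [h1, LinearMap.range_dualMap_eq_dualAnnihilator_ker, Submodule.mem_dualAnnihilator]
    -- The kernel of an odd power of `π(v)` lies in the sum of the range of `π(v)` and of the
    -- kernel of the preceding even power.
    intro x hx
    rw [LinearMap.mem_ker, pow_succ', aeval_mul_apply] at hx
    obtain ⟨y, hy⟩ := hv.mem_range π hπ i _ hx ⟨x, rfl⟩
    rw [pow_succ, aeval_mul_apply] at hy
    have h2 : x = aeval v π y + (x - aeval v π y) := by abel
    have h3 := LinearMap.congr_fun hφ y
    rw [aeval_dualMap_apply, LinearMap.zero_apply] at h3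
    rw [h2, map_add, h3, aeval_dualMap_apply, map_sub, hy, sub_self, map_zero, add_zero]

theorem isBalanced_extension_iff {δ : F} {v : Module.End F V} :
    IsBalanced δ (SymplecticPair.extension v).endo ↔ IsBalanced δ v := by
  change IsBalanced δ (v.prodMap v.dualMap : Module.End F (V × Dual F V)) ↔ _
  refine ⟨fun h => ⟨fun g => ?_, fun π hπ i x hx hxi => ?_⟩, fun h => h.prodMap h.dualMap⟩
  · have := h.finrank_ker g
    rw [finrank_ker_aeval_prodMap, finrank_ker_aeval_prodMap, finrank_ker_aeval_dualMap,
      finrank_ker_aeval_dualMap] at this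
    omega
  · obtain ⟨y, rfl⟩ := hxi
    obtain ⟨t, ht⟩ := h.mem_range π hπ i (aeval v (π ^ (2 * i)) y, 0)
      (by rw [aeval_prodMap_apply]; exact Prod.ext hx (map_zero _))
      ⟨(y, 0), by rw [aeval_prodMap_apply]; exact Prod.ext rfl (map_zero _)⟩
    rw [aeval_prodMap_apply] at ht
    exact ⟨t.1, congrArg Prod.fst ht⟩

theorem finrank_ker_aeval_piMap [Fintype ι] [∀ i, FiniteDimensional F (M i)]
    (u : ∀ i, Module.End F (M i)) (g : F[X]) : finrank F (LinearMap.ker (aeval (piMap u) g)) =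
      ∑ i, finrank F (LinearMap.ker (aeval (u i) g)) := by
  rw [← finrank_pi_fintype]
  refine LinearEquiv.finrank_eq
    { toFun := fun z i => ⟨z.1 i, ?_⟩
      invFun := fun z => ⟨fun i => (z i).1, ?_⟩
      map_add' := fun _ _ => rfl
      map_smul' := fun _ _ => rfl
      left_inv := fun _ => rfl
      right_inv := fun _ => rfl }
  · have := z.2
    rw [LinearMap.mem_ker] at this
    rw [LinearMap.mem_ker, ← aeval_piMap_apply, this]
    rfl
  · rw [LinearMap.mem_ker]
    funext i
    rw [aeval_piMap_apply]
    exact (z i).2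

theorem IsBalanced.piMap [Fintype ι] [∀ i, FiniteDimensional F (M i)] {δ : F}
    {u : ∀ i, Module.End F (M i)} (hu : ∀ i, IsBalanced δ (u i)) : IsBalanced δ (piMap u) where
  finrank_ker g := by
    rw [finrank_ker_aeval_piMap, finrank_ker_aeval_piMap]
    exact Finset.sum_congr rfl fun i _ => (hu i).finrank_ker g
  mem_range π hπ i z := by
    rintro hz ⟨y, rfl⟩
    have h : ∀ j, ∃ t, aeval (u j) (π ^ (2 * i + 1)) t = aeval (u j) (π ^ (2 * i)) (y j) := by
      intro j
      refine (hu j).mem_range π hπ i _ ?_ ⟨_, rfl⟩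
      have := congrFun hz j
      rwa [aeval_piMap_apply, aeval_piMap_apply] at this
    choose t ht using h
    exact ⟨t, funext fun j => by rw [aeval_piMap_apply, aeval_piMap_apply, ht]⟩

end BalancedSums

/-! ### Balanced cyclic endomorphisms -/

section CyclicBalanced

variable {F L : Type*} [Field F] [AddCommGroup L] [Module F L]

/-- A cyclic endomorphism whose minimal polynomial is a polynomial in `t ^ 2 - δ t` is balanced: in
the basis `(1, t)` of `F[t]` over `F[t ^ 2 - δ t]`, the reflection and the coefficient on `t` are
well defined modulo that polynomial. -/
theorem IsCyclicVector.isBalanced {δ : F} {c : Module.End F L} {e : L} {h : F[X]}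
    (hc : IsCyclicVector c e h) (h0 : h ≠ 0) (hh : IsCompQuad δ h) : IsBalanced δ c := by
  obtain ⟨r, rfl⟩ := hh
  have hr : r ≠ 0 := by rintro rfl; simp at h0
  -- `F[t] / (r(t ^ 2 - δ t))` is `R[t] / (t ^ 2 - δ t - γ)`, with coordinates relative to `(1, t)`;
  -- there `c'` is the multiplication by `t`, `σ` is the reflection and `a` the coefficient on `t`.
  let R := AdjoinRoot r
  let γ : R := AdjoinRoot.root r
  have : FiniteDimensional F R := (AdjoinRoot.powerBasis hr).finite
  let c' : Module.End F (R × R) := LinearMap.prod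
    ((LinearMap.mulLeft F γ).comp (LinearMap.snd F R R))
    (LinearMap.fst F R R + δ • LinearMap.snd F R R)
  let σ : Module.End F (R × R) := LinearMap.prod (LinearMap.fst F R R + δ • LinearMap.snd F R R)
    (-LinearMap.snd F R R)
  let a : Module.End F (R × R) := LinearMap.prod (LinearMap.snd F R R) 0
  have hc' : ∀ z, c' z = (γ * z.2, z.1 + δ • z.2) := fun _ => rfl
  have hσ : ∀ z, σ z = (z.1 + δ • z.2, -z.2) := fun _ => rfl
  have ha : ∀ z, a z = (z.2, 0) := fun _ => rfl
  have hquad : aeval c' (quad δ) = Algebra.lsmul F F (R × R) γ := by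
    refine LinearMap.ext fun z => Prod.ext ?_ ?_ <;>
      simp [quad, pow_two, hc', Algebra.algebraMap_eq_smul_one, mul_add]
  have hcomp : ∀ f : F[X], aeval c' (f.comp (quad δ)) =
      Algebra.lsmul F F (R × R) (AdjoinRoot.mk r f) := by
    intro f
    rw [aeval_comp, hquad, aeval_algHom_apply, AdjoinRoot.aeval_eq]
  have hcyc : IsCyclicVector c' ((1, 0) : R × R) (r.comp (quad δ)) := by
    have key : ∀ f g : F[X], aeval c' (f.comp (quad δ) + g.comp (quad δ) * X) ((1, 0) : R × R) =
        (AdjoinRoot.mk r f, AdjoinRoot.mk r g) := by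
      intro f g
      rw [aeval_add_apply, aeval_mul_apply, hcomp, hcomp, aeval_X, hc']
      simp
    refine ⟨fun z => ?_, fun g => ⟨fun hg => ?_, fun hg => aeval_apply_of_dvd hg ?_⟩⟩
    · obtain ⟨f, hf⟩ := AdjoinRoot.mk_surjective z.1
      obtain ⟨g, hg⟩ := AdjoinRoot.mk_surjective z.2
      exact ⟨_, (key f g).trans (Prod.ext hf hg)⟩
    · obtain ⟨f₀, f₁, rfl⟩ := exists_eq_comp_quad_add δ g
      rw [key, Prod.mk_eq_zero, AdjoinRoot.mk_eq_zero, AdjoinRoot.mk_eq_zero] at hg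
      obtain ⟨⟨k₀, rfl⟩, ⟨k₁, rfl⟩⟩ := hg
      rw [mul_comp, mul_comp]
      exact dvd_add (dvd_mul_right _ _) ((dvd_mul_right _ _).mul_right _)
    · rw [hcomp, AdjoinRoot.mk_self, map_zero, LinearMap.zero_apply]
  obtain ⟨φ, hφ⟩ := hcyc.exists_equiv hc
  refine IsBalanced.congr (IsBalanced.of_exists (G := σ) (a := a) (w := 1) ?_ ?_ ?_ ?_) φ hφ
  · rw [injective_iff_map_eq_zero]
    intro z hz
    rw [hσ, Prod.mk_eq_zero] at hz
    have h2 : z.2 = 0 := neg_eq_zero.1 hz.2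
    have h1 := hz.1
    rw [h2, smul_zero, add_zero] at h1
    exact Prod.ext h1 h2
  · refine LinearMap.ext fun z => Prod.ext ?_ ?_
    · simp [hc', hσ, Algebra.algebraMap_eq_smul_one]
      ring
    · simp [hc', hσ, Algebra.algebraMap_eq_smul_one]
      abel
  · refine LinearMap.ext fun z => Prod.ext ?_ ?_
    · simp [hc', ha, Algebra.algebraMap_eq_smul_one]
      abel
    · simp [hc', ha, Algebra.algebraMap_eq_smul_one]
  · intro π hπ hd
    exact absurd (isUnit_of_dvd_one hd) hπ.irreducible.not_isUnit

end CyclicBalanced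

/-! ### Invariant factors -/

section InvariantFactors

open Module

variable {F V : Type*} [Field F] [AddCommGroup V] [Module F V]

theorem HasOrder.of_pow {u : Module.End F V} {x : V} {π : F[X]} (hπ : Irreducible π) {n : ℕ}
    (h1 : aeval u (π ^ (n + 1)) x = 0) (h2 : aeval u (π ^ n) x ≠ 0) :
    HasOrder u x (π ^ (n + 1)) := by
  classical
  refine fun g => ⟨fun hg => ?_, fun hg => aeval_apply_of_dvd hg h1⟩
  have hd : aeval u (EuclideanDomain.gcd g (π ^ (n + 1))) x = 0 := by
    rw [EuclideanDomain.gcd_eq_gcd_ab, aeval_add_apply, mul_comm, aeval_mul_apply, hg, mul_comm,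
      aeval_mul_apply, h1, map_zero, map_zero, add_zero]
  obtain ⟨k, hk, hkd⟩ :=
    (dvd_prime_pow hπ.prime _).1 (EuclideanDomain.gcd_dvd_right g (π ^ (n + 1)))
  rcases Nat.lt_or_ge n k with h | h
  · rw [show k = n + 1 by omega] at hkd
    exact hkd.symm.dvd.trans (EuclideanDomain.gcd_dvd_left _ _)
  · exact absurd (aeval_apply_of_dvd (hkd.dvd.trans (pow_dvd_pow π h)) hd) h2

theorem HasOrder.add {u : Module.End F V} {x y : V} {f g : F[X]} (hx : HasOrder u x f)
    (hy : HasOrder u y g) (hfg : IsCoprime f g) : HasOrder u (x + y) (f * g) := by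
  refine fun k => ⟨fun hk => ?_, fun hk => ?_⟩
  · have h1 : ∀ l : F[X], aeval u l (aeval u k x) + aeval u l (aeval u k y) = 0 := by
      intro l
      rw [← map_add, ← map_add, hk, map_zero]
    have hf : f ∣ k := by
      have h2 := h1 g
      rw [aeval_apply_comm u g k y, hy.aeval_self, map_zero, add_zero, ← aeval_mul_apply, hx] at h2
      exact hfg.dvd_of_dvd_mul_left h2
    have hg : g ∣ k := by
      have h2 := h1 f
      rw [aeval_apply_comm u f k x, hx.aeval_self, map_zero, zero_add, ← aeval_mul_apply, hy] at h2
      exact hfg.symm.dvd_of_dvd_mul_left h2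
    exact hfg.mul_dvd hf hg
  · rw [map_add, (hx k).2 ((dvd_mul_right f g).trans hk), (hy k).2 ((dvd_mul_left g f).trans hk),
      add_zero]

theorem exists_hasOrder_of_dvd [FiniteDimensional F V] (u : Module.End F V) {d : F[X]}
    (hd : d ∣ minpoly F u) : ∃ x, HasOrder u x d := by
  have hμ0 : minpoly F u ≠ 0 := minpoly.ne_zero (Algebra.IsIntegral.isIntegral u)
  induction d using UniqueFactorizationMonoid.induction_on_coprime with
  | h0 => exact absurd (zero_dvd_iff.1 hd) hμ0
  | h1 hu => exact ⟨0, fun g => by simp [hu.dvd]⟩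
  | @hpr π n hπ =>
    rcases n with _ | n
    · exact ⟨0, fun g => by simp⟩
    obtain ⟨m, hm⟩ := hd
    have hne : aeval u (π ^ n * m) ≠ 0 := by
      intro h0
      have h1 := minpoly.dvd F u h0
      have hm0 : m ≠ 0 := by rintro rfl; simp [hm] at hμ0
      rw [hm, mul_dvd_mul_iff_right hm0, pow_dvd_pow_iff hπ.ne_zero hπ.not_isUnit] at h1
      omega
    obtain ⟨z, hz⟩ : ∃ z, aeval u (π ^ n * m) z ≠ 0 := by
      by_contra! h
      exact hne (LinearMap.ext h)
    refine ⟨aeval u m z, HasOrder.of_pow hπ.irreducible ?_ ?_⟩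
    · rw [← aeval_mul_apply, ← hm, minpoly.aeval, LinearMap.zero_apply]
    · rwa [← aeval_mul_apply]
  | @hcp f g hfg hf hg =>
    obtain ⟨x, hx⟩ := hf ((dvd_mul_right f g).trans hd)
    obtain ⟨y, hy⟩ := hg ((dvd_mul_left g f).trans hd)
    exact ⟨x + y, hx.add hy hfg.isCoprime⟩

/-- The multiplication by `t` in `F[t] / (f)`. -/
def quotientMulX (f : F[X]) : Module.End F (F[X] ⧸ Ideal.span {f}) :=
  Algebra.lsmul F F (F[X] ⧸ Ideal.span {f}) (X : F[X])

theorem isCyclicVector_quotientMulX (f : F[X]) :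
    IsCyclicVector (quotientMulX f) (Ideal.Quotient.mk (Ideal.span {f}) 1) f := by
  have h : ∀ g : F[X], aeval (quotientMulX f) g (Ideal.Quotient.mk (Ideal.span {f}) 1) =
      Ideal.Quotient.mk (Ideal.span {f}) g := by
    intro g
    rw [quotientMulX, aeval_algHom_apply, aeval_X_left_apply, Algebra.lsmul_apply,
      ← Ideal.Quotient.mk_eq_mk, ← Submodule.Quotient.mk_smul, smul_eq_mul, mul_one]
    rfl
  refine ⟨fun z => ?_, fun g => ?_⟩
  · obtain ⟨g, rfl⟩ := Ideal.Quotient.mk_surjective z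
    exact ⟨g, h g⟩
  · rw [h, Ideal.Quotient.eq_zero_iff_dvd]

theorem nonempty_equiv_iff {u : Module.End F V} {k : ℕ} {f : Fin k → F[X]} :
    Nonempty (Module.AEval' u ≃ₗ[F[X]] ((i : Fin k) → F[X] ⧸ Ideal.span {f i})) ↔
      ∃ φ : V ≃ₗ[F] ((i : Fin k) → F[X] ⧸ Ideal.span {f i}),
        ∀ x, φ (u x) = piMap (fun i => quotientMulX (f i)) (φ x) := by
  constructor
  · rintro ⟨E⟩
    refine ⟨(Module.AEval'.of u).trans (E.restrictScalars F), fun x => ?_⟩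
    have h : Module.AEval'.of u (u x) = (X : F[X]) • Module.AEval'.of u x :=
      (Module.AEval.X_smul_of u x).symm
    simp only [LinearEquiv.trans_apply, LinearEquiv.restrictScalars_apply]
    rw [h, map_smul]
    rfl
  · rintro ⟨φ, hφ⟩
    exact ⟨LinearEquiv.ofAEval u φ hφ⟩

/-- A cyclic invariant subspace on which `u` has the same minimal polynomial as on the whole space
has an invariant complement. -/
theorem exists_isCompl_range_evalAt [FiniteDimensional F V] {u : Module.End F V} {x : V}
    (hx : HasOrder u x (minpoly F u)) :
    ∃ Y : Submodule F V, IsCompl (LinearMap.range (evalAt u x)) Y ∧ ∀ y ∈ Y, u y ∈ Y := by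
  set h := minpoly F u with hh
  have hmon : h.Monic := minpoly.monic (Algebra.IsIntegral.isIntegral u)
  have hc := isCyclicVector_quotientMulX h
  have hker : ∀ z, aeval u h z = 0 := fun z => by rw [hh, minpoly.aeval, LinearMap.zero_apply]
  have : FiniteDimensional F (F[X] ⧸ Ideal.span {h}) := hmon.finite_quotient
  obtain ⟨ι, hι, hιu⟩ := hc.exists_lift hx.aeval_self
  have hinj := hc.injective_of_hasOrder hx hι
  obtain ⟨ℓ, hℓ⟩ := hc.exists_dual hmon
  obtain ⟨φ, hφ⟩ := LinearMap.dualMap_surjective_of_injective hinj ℓ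
  have hφ' : ∀ l, φ (ι l) = ℓ l := fun l => LinearMap.congr_fun hφ l
  -- The complement is the largest invariant subspace in the kernel of a linear form `φ` that
  -- extends the Frobenius form of the cyclic subspace.
  obtain ⟨κ, hκ, -⟩ := hc.exists_lift (w := (u.dualMap : Module.End F (Dual F V))) (y := φ)
    (LinearMap.ext fun z => by rw [aeval_dualMap_apply, hker, map_zero, LinearMap.zero_apply])
  have hmem : ∀ z, z ∈ LinearMap.ker κ.flip ↔ ∀ g : F[X], φ (aeval u g z) = 0 := by
    intro z
    rw [LinearMap.mem_ker, LinearMap.ext_iff]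
    constructor
    · intro hz g
      rw [← aeval_dualMap_apply, ← hκ]
      exact hz _
    · intro hz l
      obtain ⟨g, rfl⟩ := hc.exists_eq l
      rw [LinearMap.flip_apply, hκ, aeval_dualMap_apply, hz, LinearMap.zero_apply]
  refine ⟨LinearMap.ker κ.flip, ?_, fun y hy => ?_⟩
  · refine (Submodule.isCompl_iff_disjoint _ _ ?_).2 ?_
    · have h1 := LinearMap.finrank_range_add_finrank_ker κ.flip
      have h2 := Submodule.finrank_le (LinearMap.range κ.flip)
      rw [hx.finrank_range, ← hc.finrank_eq]
      rw [Subspace.dual_finrank_eq] at h2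
      omega
    · rw [Submodule.disjoint_def]
      rintro _ ⟨g, rfl⟩ hz
      rw [hmem] at hz
      rw [evalAt_apply, ← hι]
      rw [hℓ (aeval (quotientMulX h) g (Ideal.Quotient.mk _ 1)), map_zero]
      intro k
      rw [← hφ', map_aeval_apply hιu, hι]
      exact hz k
  · rw [hmem] at hy ⊢
    intro g
    have := hy (g * X)
    rwa [aeval_mul_apply, aeval_X] at this

/-- The last condition lets the induction prepend the minimal polynomial of `u` to the invariant
factors found on an invariant complement of a cyclic subspace of maximal dimension. -/
theorem exists_hasInvariantFactors_aux (n : ℕ) : ∀ (V : Type*) [AddCommGroup V] [Module F V]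
    [FiniteDimensional F V] (u : Module.End F V), finrank F V = n →
    ∃ (k : ℕ) (f : Fin k → F[X]), HasInvariantFactors u f ∧
      ∀ i (g : F[X]), (∀ x, aeval u g x = 0) → f i ∣ g := by
  induction n using Nat.strong_induction_on with
  | _ n ih =>
  intro V _ _ _ u hn
  rcases subsingleton_or_nontrivial V with hV | hV
  · refine ⟨0, Fin.elim0, ⟨fun i => i.elim0, fun i => i.elim0, fun i => i.elim0, ?_⟩,
      fun i => i.elim0⟩
    exact nonempty_equiv_iff.2 ⟨⟨0, 0, fun _ => Subsingleton.elim _ _,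
      fun _ => Subsingleton.elim _ _⟩, fun _ => Subsingleton.elim _ _⟩
  have hint := Algebra.IsIntegral.isIntegral (R := F) u
  set h := minpoly F u with hh
  have hmon : h.Monic := minpoly.monic hint
  have hker : ∀ z, aeval u h z = 0 := fun z => by rw [hh, minpoly.aeval, LinearMap.zero_apply]
  obtain ⟨x, hx⟩ := exists_hasOrder_of_dvd u (dvd_refl (minpoly F u))
  obtain ⟨Y, hXY, hY⟩ := exists_isCompl_range_evalAt hx
  have hYX : ∀ (g : F[X]) (y : Y), ((aeval (u.restrict hY) g y : Y) : V) = aeval u g y :=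
    fun g y => map_aeval_apply (u := u.restrict hY) (φ := Y.subtype) (fun _ => rfl) g y
  have hfin : finrank F Y < n := by
    have h1 := Submodule.finrank_add_eq_of_isCompl hXY
    have h2 := hx.finrank_range
    have h3 := minpoly.natDegree_pos hint
    omega
  obtain ⟨k, f, hf, hfann⟩ := ih _ hfin Y (u.restrict hY) rfl
  obtain ⟨ψ, hψ⟩ := nonempty_equiv_iff.1 hf.equiv
  have hfh : ∀ i, f i ∣ h := fun i => hfann i h fun y => Subtype.ext (by rw [hYX, hker]; rfl)
  let f' : Fin (k + 1) → F[X] := Fin.cons h f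
  have hc : IsCyclicVector (quotientMulX (f' 0)) (Ideal.Quotient.mk (Ideal.span {f' 0}) 1) h :=
    isCyclicVector_quotientMulX h
  have hX : ∀ z ∈ LinearMap.range (evalAt u x), u z ∈ LinearMap.range (evalAt u x) := by
    rintro _ ⟨g, rfl⟩
    exact ⟨X * g, by rw [evalAt_apply, aeval_mul_apply, aeval_X, evalAt_apply]⟩
  set c : Module.End F (LinearMap.range (evalAt u x)) := u.restrict hX
  have hcX : IsCyclicVector c ⟨x, 1, by simp⟩ h := by
    have hcX : ∀ (g : F[X]) (y : LinearMap.range (evalAt u x)), ((aeval c g y :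
        LinearMap.range (evalAt u x)) : V) = aeval u g y :=
      fun g y => map_aeval_apply (u := c) (φ := (LinearMap.range (evalAt u x)).subtype)
        (fun _ => rfl) g y
    refine ⟨?_, fun g => ?_⟩
    · rintro ⟨_, g, rfl⟩
      exact ⟨g, Subtype.ext (hcX g _)⟩
    · rw [← hx g, ← Subtype.coe_inj, hcX]
      rfl
  obtain ⟨θ, hθ⟩ := hcX.exists_equiv hc
  refine ⟨k + 1, f', ⟨Fin.cases hmon hf.monic, Fin.cases (minpoly.natDegree_pos hint)
    hf.natDegree_pos, ?_, nonempty_equiv_iff.2 ?_⟩, ?_⟩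
  · refine Fin.cases (fun j _ => ?_) fun i j hij => ?_
    · exact Fin.cases (dvd_refl h) hfh j
    · obtain ⟨j, rfl⟩ := Fin.exists_succ_eq.2 (ne_of_gt (lt_of_lt_of_le (Fin.succ_pos i) hij))
      exact hf.dvd i j (Fin.succ_le_succ_iff.1 hij)
  · let P := Submodule.prodEquivOfIsCompl _ _ hXY
    let E := (P.symm.trans (θ.prodCongr ψ)).trans
      (Fin.consLinearEquiv F fun i => F[X] ⧸ Ideal.span {f' i})
    have hE : ∀ z, E (P z) = Fin.consLinearEquiv F (fun i => F[X] ⧸ Ideal.span {f' i})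
        (θ z.1, ψ z.2) := fun z => congrArg
          (fun y : LinearMap.range (evalAt u x) × Y => Fin.consLinearEquiv F
            (fun i => F[X] ⧸ Ideal.span {f' i}) (θ y.1, ψ y.2)) (P.symm_apply_apply z)
    refine ⟨E, fun z => ?_⟩
    obtain ⟨⟨a, b⟩, rfl⟩ := P.surjective z
    have h1 : u (P (a, b)) = P (c a, u.restrict hY b) := by
      rw [Submodule.coe_prodEquivOfIsCompl', Submodule.coe_prodEquivOfIsCompl', map_add]
      rfl
    rw [h1, hE, hE]
    funext i
    refine Fin.cases (hθ a) (fun i => congrFun (hψ b) i) i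
  · refine Fin.cases (fun g hg => minpoly.dvd F u (LinearMap.ext hg)) fun i g hg => ?_
    exact hfann i g fun y => Subtype.ext (by rw [hYX, hg]; rfl)

/-- Every endomorphism of a finite-dimensional vector space has a sequence of invariant factors. -/
theorem exists_hasInvariantFactors [FiniteDimensional F V] (u : Module.End F V) :
    ∃ (k : ℕ) (f : Fin k → F[X]), HasInvariantFactors u f :=
  let ⟨k, f, h, _⟩ := exists_hasInvariantFactors_aux _ V u rfl
  ⟨k, f, h⟩

theorem HasInvariantFactors.finite {u : Module.End F V} {k : ℕ} {f : Fin k → F[X]}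
    (hf : HasInvariantFactors u f) (i : Fin k) :
    FiniteDimensional F (F[X] ⧸ Ideal.span {f i}) := (hf.monic i).finite_quotient

theorem isBalanced_of_forall_isCompQuad [FiniteDimensional F V] {δ : F} {u : Module.End F V}
    (hu : ∀ g, IsInvariantFactor u g → IsCompQuad δ g) : IsBalanced δ u := by
  obtain ⟨k, f, hf⟩ := exists_hasInvariantFactors u
  obtain ⟨φ, hφ⟩ := nonempty_equiv_iff.1 hf.equiv
  have := hf.finite
  refine IsBalanced.congr (IsBalanced.piMap (u := fun i => quotientMulX (f i)) fun i => ?_)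
    φ.symm fun z => ?_
  · exact (isCyclicVector_quotientMulX (f i)).isBalanced (hf.monic i).ne_zero
      (hu (f i) ⟨k, f, hf, i, rfl⟩)
  · rw [LinearEquiv.symm_apply_eq, hφ, LinearEquiv.apply_symm_apply]

theorem isCompQuad_of_isBalanced [FiniteDimensional F V] {δ : F} {u : Module.End F V}
    (hu : IsBalanced δ u) {g : F[X]} (hg : IsInvariantFactor u g) : IsCompQuad δ g := by
  classical
  obtain ⟨k, f, hf, j, rfl⟩ := hg
  obtain ⟨φ, hφ⟩ := nonempty_equiv_iff.1 hf.equiv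
  have := hf.finite
  have hb := hu.congr φ hφ
  have hc := fun i => isCyclicVector_quotientMulX (f i)
  have hf0 := fun i => (hf.monic i).ne_zero
  refine isCompQuad_of_annihilator (hf0 j) (hc j).aeval_eq_zero_iff ?_ ?_
  · -- The dimensions of the kernels of `f j` and of its reflection are equal. Summand by summand,
    -- the latter is at most the former, whence all the summands are equal.
    have h1 := hb.finrank_ker (f j)
    rw [finrank_ker_aeval_piMap, finrank_ker_aeval_piMap] at h1
    have hd : ∀ g : F[X], g ≠ 0 → ∀ i, (EuclideanDomain.gcd g (f i)).natDegree ≤ g.natDegree ∧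
        (EuclideanDomain.gcd g (f i)).natDegree ≤ (f i).natDegree := fun g hg i =>
      ⟨natDegree_le_of_dvd (EuclideanDomain.gcd_dvd_left _ _) hg,
        natDegree_le_of_dvd (EuclideanDomain.gcd_dvd_right _ _) (hf0 i)⟩
    have hσ0 : reflect δ (f j) ≠ 0 := fun h0 => hf0 j (reflect_injective δ (by rw [h0, map_zero]))
    have hle : ∀ i ∈ Finset.univ,
        finrank F (LinearMap.ker (aeval (quotientMulX (f i)) (reflect δ (f j)))) ≤
        finrank F (LinearMap.ker (aeval (quotientMulX (f i)) (f j))) := by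
      intro i _
      rw [(hc i).finrank_ker_aeval (hf0 i), (hc i).finrank_ker_aeval (hf0 i)]
      obtain ⟨h2, h3⟩ := hd (reflect δ (f j)) hσ0 i
      rw [natDegree_reflect] at h2
      have hg0 : EuclideanDomain.gcd (f j) (f i) ≠ 0 := fun h0 =>
        hf0 i ((EuclideanDomain.gcd_eq_zero_iff.1 h0).2)
      rcases le_total i j with hij | hij
      · exact h2.trans (natDegree_le_of_dvd
          (EuclideanDomain.dvd_gcd dvd_rfl (hf.dvd _ _ hij)) hg0)
      · exact h3.trans (natDegree_le_of_dvd
          (EuclideanDomain.dvd_gcd (hf.dvd _ _ hij) dvd_rfl) hg0)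
    have h2 := (Finset.sum_eq_sum_iff_of_le hle).1 h1.symm j (Finset.mem_univ j)
    rw [(hc j).finrank_ker_aeval (hf0 j), (hc j).finrank_ker_aeval (hf0 j),
      EuclideanDomain.gcd_self] at h2
    have h3 := EuclideanDomain.gcd_dvd_right (reflect δ (f j)) (f j)
    have h4 : Associated (EuclideanDomain.gcd (reflect δ (f j)) (f j)) (f j) :=
      associated_of_dvd_of_natDegree_le h3 (hf0 j) h2.ge
    exact h4.symm.dvd.trans (EuclideanDomain.gcd_dvd_left _ _)
  · intro π hπ i x hx hxi
    obtain ⟨y, rfl⟩ := hxi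
    have hs : ∀ (g : F[X]) (z : F[X] ⧸ Ideal.span {f j}),
        aeval (piMap fun i => quotientMulX (f i)) g (Pi.single j z) =
          Pi.single j (aeval (quotientMulX (f j)) g z) := by
      intro g z
      funext l
      rw [aeval_piMap_apply]
      by_cases hl : l = j
      · subst hl; simp
      · simp [hl]
    obtain ⟨t, ht⟩ := hb.mem_range π hπ i (Pi.single j (aeval (quotientMulX (f j)) (π ^ (2 * i)) y))
      (by rw [hs, hx, Pi.single_zero]) ⟨Pi.single j y, hs _ _⟩
    refine ⟨t j, ?_⟩
    rw [← aeval_piMap_apply (fun i => quotientMulX (f i)), ht, Pi.single_eq_same]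

end InvariantFactors

/-! ### Companion matrices -/

section Companion

open Module

variable {F V : Type*} [Field F] [AddCommGroup V] [Module F V]

theorem isCyclicVector_of_toMatrix_eq {h : F[X]} (hh : h.Monic) (hpos : 0 < h.natDegree)
    (b : Basis (Fin h.natDegree) F V) {v : Module.End F V}
    (hv : LinearMap.toMatrix b b v = companionMatrix h) : IsCyclicVector v (b ⟨0, hpos⟩) h := by
  have hv' : ∀ j, v (b j) = ∑ i, companionMatrix h i j • b i := by
    intro j
    rw [← hv, ← Matrix.toLin_self b b, Matrix.toLin_toMatrix]
  have hpow : ∀ (j : ℕ) (hj : j < h.natDegree), (v ^ j) (b ⟨0, hpos⟩) = b ⟨j, hj⟩ := by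
    intro j
    induction j with
    | zero => intro hj; rfl
    | succ j ih =>
      intro hj
      rw [pow_succ', Module.End.mul_apply, ih (by omega), hv', Finset.sum_eq_single ⟨j + 1, hj⟩]
      · simp [companionMatrix, hj.ne]
      · intro i _ hi
        have h1 : (i : ℕ) ≠ j + 1 := fun h => hi (Fin.ext h)
        simp [companionMatrix, hj.ne, h1]
      · simp
  have hlt : ∀ g : F[X], g.natDegree < h.natDegree →
      aeval v g (b ⟨0, hpos⟩) = ∑ i : Fin h.natDegree, g.coeff i • b i := by
    intro g hg
    rw [aeval_eq_sum_range' hg, LinearMap.sum_apply,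
      Finset.sum_range fun i => (g.coeff i • v ^ i) (b ⟨0, hpos⟩)]
    exact Finset.sum_congr rfl fun i _ => by rw [LinearMap.smul_apply, hpow i i.2]
  have hzero : aeval v h (b ⟨0, hpos⟩) = 0 := by
    rw [aeval_eq_sum_range, Finset.sum_range_succ, LinearMap.add_apply, LinearMap.sum_apply,
      Finset.sum_range fun i => (h.coeff i • v ^ i) (b ⟨0, hpos⟩), coeff_natDegree,
      hh.leadingCoeff, one_smul]
    have h1 : (v ^ h.natDegree) (b ⟨0, hpos⟩) = v (b ⟨h.natDegree - 1, by omega⟩) := by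
      rw [← hpow (h.natDegree - 1) (by omega), ← Module.End.mul_apply, ← pow_succ',
        Nat.sub_add_cancel hpos]
    rw [h1, hv', ← Finset.sum_add_distrib]
    refine Finset.sum_eq_zero fun i _ => ?_
    rw [LinearMap.smul_apply, hpow i i.2]
    simp [companionMatrix, show h.natDegree - 1 + 1 = h.natDegree by omega]
  refine ⟨fun l => ?_, fun g => ⟨fun hg => ?_, fun hg => aeval_apply_of_dvd hg hzero⟩⟩
  · refine ⟨∑ i : Fin h.natDegree, C (b.repr l i) * X ^ (i : ℕ), ?_⟩
    rw [map_sum, LinearMap.sum_apply]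
    conv_rhs => rw [← b.sum_repr l]
    refine Finset.sum_congr rfl fun i _ => ?_
    rw [aeval_mul_apply, aeval_C, aeval_X_pow, hpow i i.2, Module.algebraMap_end_apply]
  · have h1 : aeval v (g %ₘ h) (b ⟨0, hpos⟩) = 0 := by
      have h2 := congrArg (fun f => aeval v f (b ⟨0, hpos⟩)) (modByMonic_add_div g h)
      simp only [aeval_add_apply, hg] at h2
      rwa [mul_comm, aeval_mul_apply, hzero, map_zero, add_zero] at h2
    have hdeg : (g %ₘ h).natDegree < h.natDegree :=
      natDegree_modByMonic_lt g hh (by rintro rfl; simp at hpos)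
    rw [hlt _ hdeg] at h1
    have h3 := Fintype.linearIndependent_iff.1 b.linearIndependent _ h1
    rw [← modByMonic_eq_zero_iff_dvd hh]
    ext i
    rcases lt_or_ge i h.natDegree with hi | hi
    · exact h3 ⟨i, hi⟩
    · exact coeff_eq_zero_of_natDegree_lt (hdeg.trans_le hi)

theorem isCyclicVector_companionMatrix {h : F[X]} (hh : h.Monic) (hpos : 0 < h.natDegree) :
    ∃ e, IsCyclicVector (Matrix.toLin' (companionMatrix h)) e h :=
  ⟨_, isCyclicVector_of_toMatrix_eq hh hpos (Pi.basisFun F _) (by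
    rw [LinearMap.toMatrix_eq_toMatrix', LinearMap.toMatrix'_toLin'])⟩

end Companion

namespace SymplecticPair

/-! ### Hyperbolic summands of symplectic pairs -/

section Hyperbolic

open Module

variable {F V W L : Type*} [Field F] [AddCommGroup V] [Module F V] [AddCommGroup W] [Module F W]
  [AddCommGroup L] [Module F L] (s : SymplecticPair F V)

theorem form_neg (x y : V) : -s.form x y = s.form y x := s.isAlt.neg_eq x y

theorem form_endo (x y : V) : s.form x (s.endo y) = s.form (s.endo x) y := by
  have h := s.endo_alternating (x + y)
  simp only [map_add, LinearMap.add_apply, s.endo_alternating, zero_add, add_zero] at h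
  rw [← s.form_neg y (s.endo x), eq_neg_iff_add_eq_zero, add_comm]
  exact h

theorem form_aeval (g : F[X]) (x y : V) :
    s.form x (aeval s.endo g y) = s.form (aeval s.endo g x) y := by
  induction g using Polynomial.induction_on generalizing x y with
  | C c => simp [Module.algebraMap_end_apply]
  | add f g hf hg => simp only [map_add, LinearMap.add_apply, hf, hg]
  | monomial n c ih =>
    rw [pow_succ, ← mul_assoc, aeval_mul_apply _ _ X y, ih, aeval_X, form_endo, mul_comm _ X,
      aeval_mul_apply _ X, aeval_X]

/-- Every cyclic subspace is totally isotropic. -/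
theorem form_aeval_self (g : F[X]) (x : V) : s.form x (aeval s.endo g x) = 0 := by
  induction g using Polynomial.induction_on' with
  | add f g hf hg => rw [aeval_add_apply, map_add, hf, hg, add_zero]
  | monomial n c =>
    rw [← C_mul_X_pow_eq_monomial, aeval_mul_apply, aeval_C, Module.algebraMap_end_apply, map_smul]
    obtain ⟨k, rfl | rfl⟩ := n.even_or_odd'
    · rw [two_mul, pow_add, aeval_mul_apply, form_aeval, s.isAlt.self_eq_zero, smul_zero]
    · rw [two_mul, add_assoc, pow_add, aeval_mul_apply, form_aeval, pow_succ', aeval_mul_apply,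
        aeval_X, s.endo_alternating, smul_zero]

theorem form_aeval_aeval (f g : F[X]) (x : V) :
    s.form (aeval s.endo f x) (aeval s.endo g x) = 0 := by
  rw [← form_aeval, ← aeval_mul_apply, form_aeval_self]

/-- If `x` has order `h`, and `h` is coprime to its cofactor in an annihilating polynomial, then the
cyclic subspace generated by `x` is part of an invariant hyperbolic plane over `F[t] / (h)`: it is
paired perfectly with the cyclic subspace generated by some `y`, and both are isotropic. -/
theorem exists_hyperbolic_embedding [FiniteDimensional F V] [FiniteDimensional F L] {h h' : F[X]}
    (hh : h.Monic) (hcop : IsCoprime h h') (hker : ∀ x, aeval s.endo (h * h') x = 0) {x : V}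
    (hx : HasOrder s.endo x h) {c : Module.End F L} {e : L} (hc : IsCyclicVector c e h) :
    ∃ Φ : L × Dual F L →ₗ[F] V, (∀ z z', s.form (Φ z) (Φ z') = standardForm F L z z') ∧
      ∀ z, Φ ((extension c).endo z) = s.endo (Φ z) := by
  obtain ⟨ι, hι, hιu⟩ := hc.exists_lift hx.aeval_self
  have hinj := hc.injective_of_hasOrder hx hι
  obtain ⟨ℓ, hℓ⟩ := hc.exists_dual hh
  obtain ⟨φ, hφ⟩ := LinearMap.dualMap_surjective_of_injective hinj ℓ
  have hφ' : ∀ l, φ (ι l) = ℓ l := fun l => LinearMap.congr_fun hφ l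
  obtain ⟨α, β, hαβ⟩ := hcop
  -- a vector representing an extension of the Frobenius form, and its `h`-primary component
  set y₀ : V := (s.form.toDual s.nondegenerate).symm φ with hy₀
  have hy₀' : ∀ z, s.form y₀ z = φ z := fun z => by
    rw [hy₀, ← LinearMap.BilinForm.toDual_def s.nondegenerate, LinearEquiv.apply_symm_apply]
  set y : V := aeval s.endo (β * h') y₀ with hy
  have hyh : aeval s.endo h y = 0 := by
    rw [hy, ← aeval_mul_apply, show h * (β * h') = β * (h * h') by ring, aeval_mul_apply, hker,
      map_zero]
  have hyι : ∀ l, s.form y (ι l) = ℓ l := by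
    intro l
    rw [hy, ← form_aeval, ← map_aeval_apply hιu, hy₀', hφ']
    congr 1
    have h1 : aeval c (α * h + β * h') l = l := by rw [hαβ]; simp
    rwa [aeval_add_apply, aeval_mul_apply, hc.aeval_apply_eq_zero, map_zero, zero_add] at h1
  obtain ⟨κ, hκ, hκu⟩ := hc.exists_lift hyh
  obtain ⟨T, hT, hTu⟩ := hc.exists_lift (w := (c.dualMap : Module.End F (Dual F L))) (y := ℓ)
    (LinearMap.ext fun z => by
      rw [aeval_dualMap_apply, hc.aeval_apply_eq_zero, map_zero, LinearMap.zero_apply])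
  have hTinj : Function.Injective T := by
    rw [injective_iff_map_eq_zero]
    intro l hl
    obtain ⟨g, rfl⟩ := hc.exists_eq l
    refine hℓ _ fun k => ?_
    rw [aeval_apply_comm, ← aeval_dualMap_apply, ← hT, hl, LinearMap.zero_apply]
  let T' : L ≃ₗ[F] Dual F L := T.linearEquivOfInjective hTinj Subspace.dual_finrank_eq.symm
  have hT' : ∀ l, T' l = T l := fun l => rfl
  have hpair : ∀ l l', s.form (κ l) (ι l') = T l l' := by
    intro l l'
    obtain ⟨g, rfl⟩ := hc.exists_eq l
    rw [hκ, hT, ← form_aeval, ← map_aeval_apply hιu, hyι, aeval_dualMap_apply]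
  have hιι : ∀ l l', s.form (ι l) (ι l') = 0 := by
    intro l l'
    obtain ⟨f, rfl⟩ := hc.exists_eq l
    obtain ⟨g, rfl⟩ := hc.exists_eq l'
    rw [hι, hι, form_aeval_aeval]
  have hκκ : ∀ l l', s.form (κ l) (κ l') = 0 := by
    intro l l'
    obtain ⟨f, rfl⟩ := hc.exists_eq l
    obtain ⟨g, rfl⟩ := hc.exists_eq l'
    rw [hκ, hκ, form_aeval_aeval]
  refine ⟨ι.coprod (κ.comp T'.symm.toLinearMap), ?_, ?_⟩
  · rintro ⟨a, ψ⟩ ⟨b, χ⟩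
    obtain ⟨l, rfl⟩ := T'.surjective ψ
    obtain ⟨m, rfl⟩ := T'.surjective χ
    simp only [LinearMap.coprod_apply, LinearMap.comp_apply, LinearEquiv.coe_coe,
      LinearEquiv.symm_apply_apply, map_add, LinearMap.add_apply, hιι, hκκ, hpair,
      standardForm_apply]
    rw [← s.form_neg (κ m) (ι a), hpair, hT', hT']
    ring
  · rintro ⟨a, ψ⟩
    obtain ⟨l, rfl⟩ := T'.surjective ψ
    have h1 : (c.dualMap : Module.End F (Dual F L)) (T' l) = T' (c l) := (hTu l).symm
    simp only [extension, LinearMap.prodMap_apply, h1, LinearMap.coprod_apply, LinearMap.comp_apply,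
      LinearEquiv.coe_coe, LinearEquiv.symm_apply_apply, map_add, hιu, hκu]

end Hyperbolic

/-! ### Isometries and orthogonal sums -/

section Isometries

open Module

variable {F V W U : Type*} [Field F] [AddCommGroup V] [Module F V] [AddCommGroup W] [Module F W]
  [AddCommGroup U] [Module F U]

theorem Isometric.symm {s : SymplecticPair F V} {t : SymplecticPair F W} (h : s.Isometric t) :
    t.Isometric s := by
  obtain ⟨φ, h1, h2⟩ := h
  refine ⟨φ.symm, fun x y => ?_, fun x => ?_⟩
  · rw [← h1, φ.apply_symm_apply, φ.apply_symm_apply]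
  · rw [LinearEquiv.eq_symm_apply, ← h2, φ.apply_symm_apply]

theorem Isometric.trans {s : SymplecticPair F V} {t : SymplecticPair F W} {r : SymplecticPair F U}
    (h : s.Isometric t) (h' : t.Isometric r) : s.Isometric r := by
  obtain ⟨φ, h1, h2⟩ := h
  obtain ⟨ψ, h3, h4⟩ := h'
  exact ⟨φ.trans ψ, fun x y => by simp [h1, h3], fun x => by simp [h2, h4]⟩

theorem IsDifference.of_isometric {p q : F[X]} {s : SymplecticPair F V} {t : SymplecticPair F W}
    (hs : s.IsDifference p q) (h : s.Isometric t) : t.IsDifference p q := by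
  obtain ⟨φ, h1, h2⟩ := h
  obtain ⟨a, b, ha, hb, hpa, hqb, hab⟩ := hs
  have hconj : ∀ (a : Module.End F V) (x : V), φ (a x) = φ.conj a (φ x) := by simp
  have hz : ∀ (f : F[X]) (a : Module.End F V), aeval a f = 0 → aeval (φ.conj a) f = 0 := by
    intro f a hf
    ext y
    obtain ⟨x, rfl⟩ := φ.surjective y
    have h := map_aeval_apply (φ := (φ : V →ₗ[F] W)) (hconj a) f x
    rw [hf, LinearMap.zero_apply, map_zero] at h
    exact h.symm
  have halt : ∀ a : Module.End F V, (∀ x, s.form x (a x) = 0) →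
      ∀ y, t.form y (φ.conj a y) = 0 := by
    intro a ha y
    obtain ⟨x, rfl⟩ := φ.surjective y
    rw [← hconj, h1, ha]
  refine ⟨φ.conj a, φ.conj b, halt a ha, halt b hb, hz p a hpa, hz q b hqb, ?_⟩
  ext y
  obtain ⟨x, rfl⟩ := φ.surjective y
  rw [h2, hab, LinearMap.sub_apply, LinearMap.sub_apply, ← hconj, ← hconj, map_sub]

theorem IsDifference.orthogonalSum {p q : F[X]} {s : SymplecticPair F V} {t : SymplecticPair F W}
    (hs : s.IsDifference p q) (ht : t.IsDifference p q) :
    (s.orthogonalSum t).IsDifference p q := by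
  obtain ⟨a, b, ha, hb, hpa, hqb, hab⟩ := hs
  obtain ⟨a', b', ha', hb', hpa', hqb', hab'⟩ := ht
  have hz : ∀ (f : F[X]) (a : Module.End F V) (a' : Module.End F W), aeval a f = 0 →
      aeval a' f = 0 → aeval (a.prodMap a' : Module.End F (V × W)) f = 0 := by
    intro f a a' hf hf'
    refine LinearMap.ext fun z => ?_
    rw [aeval_prodMap_apply, hf, hf']
    rfl
  refine ⟨a.prodMap a', b.prodMap b', fun x => ?_, fun x => ?_, hz p a a' hpa hpa',
    hz q b b' hqb hqb', ?_⟩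
  · simp [SymplecticPair.orthogonalSum, ha, ha']
  · simp [SymplecticPair.orthogonalSum, hb, hb']
  · refine LinearMap.ext fun z => ?_
    simp [SymplecticPair.orthogonalSum, hab, hab']

theorem injective_of_form_eq {s : SymplecticPair F V} {t : SymplecticPair F W} {Φ : V →ₗ[F] W}
    (h : ∀ z z', t.form (Φ z) (Φ z') = s.form z z') : Function.Injective Φ := by
  rw [injective_iff_map_eq_zero]
  intro z hz
  refine s.nondegenerate.1 z fun z' => ?_
  rw [← h, hz, map_zero, LinearMap.zero_apply]

/-- The restriction of a symplectic pair to an invariant nondegenerate subspace. -/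
def restrict (s : SymplecticPair F V) (X : Submodule F V) (hX : ∀ x ∈ X, s.endo x ∈ X)
    (hnd : (s.form.restrict X).Nondegenerate) : SymplecticPair F X where
  form := s.form.restrict X
  endo := s.endo.restrict hX
  isAlt x := s.isAlt x
  nondegenerate := hnd
  endo_alternating x := s.endo_alternating x

/-- The image of an isometric intertwining map into a symplectic pair is an orthogonal summand. -/
theorem exists_isometric_orthogonalSum [FiniteDimensional F V] {s : SymplecticPair F V}
    {t : SymplecticPair F W} {Φ : W →ₗ[F] V} (hform : ∀ z z', s.form (Φ z) (Φ z') = t.form z z')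
    (hendo : ∀ z, Φ (t.endo z) = s.endo (Φ z)) :
    ∃ (X Y : Submodule F V) (s₁ : SymplecticPair F X) (s₂ : SymplecticPair F Y),
      s.Isometric (s₁.orthogonalSum s₂) ∧ s₁.Isometric t := by
  have hinj := injective_of_form_eq hform
  set X := LinearMap.range Φ with hX
  set Y := s.form.orthogonal X with hY
  have hrefl : s.form.IsRefl := s.isAlt.isRefl
  have hdisj : Disjoint X Y := by
    rw [Submodule.disjoint_def]
    rintro _ ⟨z, rfl⟩ hz
    rw [hY, LinearMap.BilinForm.mem_orthogonal_iff] at hz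
    have : z = 0 := t.nondegenerate.2 z fun z' => by
      rw [← hform]; exact hz _ ⟨z', rfl⟩
    rw [this, map_zero]
  have hXnd := s.form.nondegenerate_restrict_of_disjoint_orthogonal hrefl hdisj
  have hYnd : (s.form.restrict Y).Nondegenerate := by
    refine s.form.nondegenerate_restrict_of_disjoint_orthogonal hrefl ?_
    rw [hY, LinearMap.BilinForm.orthogonal_orthogonal s.nondegenerate hrefl]
    exact hdisj.symm
  have hXY : IsCompl X Y :=
    LinearMap.BilinForm.isCompl_orthogonal_of_restrict_nondegenerate hrefl hXnd
  have hXu : ∀ x ∈ X, s.endo x ∈ X := by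
    rintro _ ⟨z, rfl⟩
    exact ⟨_, hendo z⟩
  have hYu : ∀ y ∈ Y, s.endo y ∈ Y := by
    intro y hy
    rw [hY, LinearMap.BilinForm.mem_orthogonal_iff] at hy ⊢
    intro x hx
    exact (s.form_endo x y).trans (hy _ (hXu x hx))
  refine ⟨X, Y, s.restrict X hXu hXnd, s.restrict Y hYu hYnd, Isometric.symm ?_, Isometric.symm ?_⟩
  · refine ⟨Submodule.prodEquivOfIsCompl X Y hXY, fun z z' => ?_, fun z => ?_⟩
    · have h1 : s.form z.1 z'.2 = 0 := z'.2.2 _ z.1.2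
      have h2 : s.form z.2 z'.1 = 0 := by
        rw [← s.form_neg, neg_eq_zero]; exact z.2.2 _ z'.1.2
      rw [Submodule.coe_prodEquivOfIsCompl', Submodule.coe_prodEquivOfIsCompl', map_add, map_add,
        LinearMap.add_apply, LinearMap.add_apply, h1, h2, add_zero, zero_add]
      rfl
    · rw [Submodule.coe_prodEquivOfIsCompl', Submodule.coe_prodEquivOfIsCompl', map_add]
      rfl
  · exact ⟨LinearEquiv.ofInjective Φ hinj, hform, fun z => Subtype.ext (hendo z).symm⟩

end Isometries

end SymplecticPair

namespace SymplecticPair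

/-! ### The quaternion algebra of two quadratic elements -/

section RegularRepresentation

open Module

variable {F : Type*} [Field F] (p q r : F[X])

/-- The left multiplication by `a` in the quaternion algebra over `R = F[γ] / (r)` generated by two
elements `a, b` with `p(a) = q(b) = 0` and `u ^ 2 - δ u = γ`, where `u = a - b`. The coordinates are
relative to the basis `(1, a, b, ab)`. -/
def mulLeftA : Module.End F
    (AdjoinRoot r × AdjoinRoot r × AdjoinRoot r × AdjoinRoot r) where
  toFun x := (p.coeff 0 • -x.2.1, x.1 - p.coeff 1 • x.2.1, p.coeff 0 • -x.2.2.2,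
    x.2.2.1 - p.coeff 1 • x.2.2.2)
  map_add' x y := by
    refine Prod.ext ?_ (Prod.ext ?_ (Prod.ext ?_ ?_)) <;> simp <;> module
  map_smul' c x := by
    refine Prod.ext ?_ (Prod.ext ?_ (Prod.ext ?_ ?_)) <;> simp <;> module

/-- The left multiplication by `b` in the same algebra, relative to the same basis. -/
def mulLeftB : Module.End F
    (AdjoinRoot r × AdjoinRoot r × AdjoinRoot r × AdjoinRoot r) where
  toFun x := (-(AdjoinRoot.root r * x.2.1) - (p.coeff 0 + q.coeff 0) • x.2.1 - q.coeff 0 • x.2.2.1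
      + (p.coeff 1 * q.coeff 0) • x.2.2.2,
    q.coeff 0 • x.2.2.2 - q.coeff 1 • x.2.1,
    x.1 - p.coeff 1 • x.2.1 - q.coeff 1 • x.2.2.1
      + (p.coeff 1 * q.coeff 1 - p.coeff 0 - q.coeff 0) • x.2.2.2 - AdjoinRoot.root r * x.2.2.2,
    -x.2.1)
  map_add' x y := by
    refine Prod.ext ?_ (Prod.ext ?_ (Prod.ext ?_ ?_)) <;> simp [mul_add] <;> module
  map_smul' c x := by
    refine Prod.ext ?_ (Prod.ext ?_ (Prod.ext ?_ ?_)) <;> simp <;> module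

variable {p q r}

theorem aeval_mulLeftA (hp : p.Monic) (hp2 : p.natDegree = 2) : aeval (mulLeftA p r) p = 0 := by
  have h := eq_of_natDegree_eq_two hp hp2
  generalize hp0 : p.coeff 0 = p₀ at h
  generalize hp1 : p.coeff 1 = p₁ at h
  conv_lhs => rw [h]
  refine LinearMap.ext fun x => Prod.ext ?_ (Prod.ext ?_ (Prod.ext ?_ ?_)) <;>
    simp [pow_two, mulLeftA, *, Module.algebraMap_end_apply] <;> module

theorem aeval_mulLeftB (hq : q.Monic) (hq2 : q.natDegree = 2) :
    aeval (mulLeftB p q r) q = 0 := by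
  have h := eq_of_natDegree_eq_two hq hq2
  generalize hq0 : q.coeff 0 = q₀ at h
  generalize hq1 : q.coeff 1 = q₁ at h
  conv_lhs => rw [h]
  refine LinearMap.ext fun x => Prod.ext ?_ (Prod.ext ?_ (Prod.ext ?_ ?_)) <;>
    simp [pow_two, mulLeftB, *, Module.algebraMap_end_apply] <;>
    simp only [Algebra.smul_def, map_add, map_sub, map_mul] <;> ring

theorem aeval_quad_mulLeft (hp2 : p.natDegree = 2) (hq2 : q.natDegree = 2) :
    aeval (mulLeftA p r - mulLeftB p q r) (quad (delta p q)) =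
      Algebra.lsmul F F _ (AdjoinRoot.root r) := by
  refine LinearMap.ext fun x => Prod.ext ?_ (Prod.ext ?_ (Prod.ext ?_ ?_)) <;>
    simp [quad, delta, polyTrace_eq hp2, polyTrace_eq hq2, pow_two, mulLeftA, mulLeftB,
      Module.algebraMap_end_apply] <;>
    simp only [Algebra.smul_def, map_add, map_sub, map_mul] <;> ring

/-- The cyclic endomorphisms whose minimal polynomial is a polynomial in `t ^ 2 - δ t` have
symplectic extensions that are differences: the extension is realized on the quaternion algebra
generated by `a` and `b`, the form being a Frobenius form applied to the coefficient on `ab` of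
`τ(x) y`, where `τ` is the involution that fixes `a` and `b`. -/
theorem isDifference_extension_of_isCyclicVector {L : Type*} [AddCommGroup L] [Module F L]
    [FiniteDimensional F L]
    (hp : p.Monic) (hp2 : p.natDegree = 2) (hq : q.Monic) (hq2 : q.natDegree = 2)
    (hr : r.Monic) {c : Module.End F L} {e : L}
    (hc : IsCyclicVector c e (r.comp (quad (delta p q)))) : (extension c).IsDifference p q := by
  let R := AdjoinRoot r
  have : FiniteDimensional F R := (AdjoinRoot.powerBasis hr.ne_zero).finite
  have hR : finrank F R = r.natDegree := by
    rw [(AdjoinRoot.powerBasis hr.ne_zero).finrank, AdjoinRoot.powerBasis_dim]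
  obtain ⟨ℓ, hℓ⟩ : ∃ ℓ : Dual F R, ∀ l, (∀ k, ℓ (k * l) = 0) → l = 0 := by
    have h1 : ∀ (g : F[X]) (l : R), aeval (Algebra.lsmul F F R (AdjoinRoot.root r)) g l =
        AdjoinRoot.mk r g * l := by
      intro g l
      rw [aeval_algHom_apply, AdjoinRoot.aeval_eq, Algebra.lsmul_apply, smul_eq_mul]
    have h2 : IsCyclicVector (Algebra.lsmul F F R (AdjoinRoot.root r)) (1 : R) r := by
      refine ⟨fun l => ?_, fun g => ?_⟩
      · obtain ⟨g, rfl⟩ := AdjoinRoot.mk_surjective l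
        exact ⟨g, by rw [h1, mul_one]⟩
      · rw [h1, mul_one, AdjoinRoot.mk_eq_zero]
    obtain ⟨ℓ, hℓ⟩ := h2.exists_dual hr
    exact ⟨ℓ, fun l hl => hℓ l fun g => by rw [h1]; exact hl _⟩
  let E := R × R × R × R
  let β : E → E → R := fun x y =>
    x.1 * y.2.2.2 - x.2.2.2 * y.1 + (x.2.1 * y.2.2.1 - x.2.2.1 * y.2.1)
    - p.coeff 1 • (x.2.1 * y.2.2.2 - x.2.2.2 * y.2.1)
  have hβ : ∀ x y, β x y = x.1 * y.2.2.2 - x.2.2.2 * y.1 + (x.2.1 * y.2.2.1 - x.2.2.1 * y.2.1)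
    - p.coeff 1 • (x.2.1 * y.2.2.2 - x.2.2.2 * y.2.1) := fun _ _ => rfl
  let B : LinearMap.BilinForm F E := LinearMap.mk₂ F (fun x y => ℓ (β x y))
    (fun x y z => by
      rw [← map_add]
      congr 1
      change (x.1 + y.1) * _ - (x.2.2.2 + y.2.2.2) * _ +
        ((x.2.1 + y.2.1) * _ - (x.2.2.1 + y.2.2.1) * _) -
        _ • ((x.2.1 + y.2.1) * _ - (x.2.2.2 + y.2.2.2) * _) = _
      simp only [hβ, Algebra.smul_def]
      ring)
    (fun c x y => by
      rw [← map_smul]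
      congr 1
      change (c • x.1) * _ - (c • x.2.2.2) * _ + ((c • x.2.1) * _ - (c • x.2.2.1) * _) -
        _ • ((c • x.2.1) * _ - (c • x.2.2.2) * _) = _
      simp only [hβ, Algebra.smul_def]
      ring)
    (fun x y z => by
      rw [← map_add]
      congr 1
      change _ * (y.2.2.2 + z.2.2.2) - _ * (y.1 + z.1) +
        (_ * (y.2.2.1 + z.2.2.1) - _ * (y.2.1 + z.2.1)) -
        _ • (_ * (y.2.2.2 + z.2.2.2) - _ * (y.2.1 + z.2.1)) = _
      simp only [hβ, Algebra.smul_def]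
      ring)
    (fun c x y => by
      rw [← map_smul]
      congr 1
      change _ * (c • y.2.2.2) - _ * (c • y.1) + (_ * (c • y.2.2.1) - _ * (c • y.2.1)) -
        _ • (_ * (c • y.2.2.2) - _ * (c • y.2.1)) = _
      simp only [hβ, Algebra.smul_def]
      ring)
  have hB : ∀ x y, B x y = ℓ (β x y) := fun _ _ => rfl
  have halt : B.IsAlt := fun x => by
    rw [hB, hβ, show x.1 * x.2.2.2 - x.2.2.2 * x.1 + (x.2.1 * x.2.2.1 - x.2.2.1 * x.2.1)
      - p.coeff 1 • (x.2.1 * x.2.2.2 - x.2.2.2 * x.2.1) = 0 by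
        simp only [Algebra.smul_def]; ring, map_zero]
  have hleft : ∀ x, (∀ y, B x y = 0) → x = 0 := by
    intro x hx
    have h2 : x.2.1 = 0 := hℓ _ fun k => by
      have := hx (0, 0, k, 0); rw [hB, hβ] at this; simpa [mul_comm] using this
    have h4 : x.2.2.2 = 0 := hℓ _ fun k => by
      have := hx (k, 0, 0, 0); rw [hB, hβ] at this; simpa [mul_comm] using this
    have h1 : x.1 = 0 := hℓ _ fun k => by
      have := hx (0, 0, 0, k); rw [hB, hβ] at this; simpa [mul_comm, h2] using this
    have h3 : x.2.2.1 = 0 := hℓ _ fun k => by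
      have := hx (0, k, 0, 0); rw [hB, hβ] at this; simpa [mul_comm, h4] using this
    exact Prod.ext h1 (Prod.ext h2 (Prod.ext h3 h4))
  have ha : ∀ x, B x (mulLeftA p r x) = 0 := fun x => by
    rw [hB, ← map_zero ℓ]
    congr 1
    rw [hβ]
    simp only [mulLeftA, LinearMap.coe_mk, AddHom.coe_mk, Algebra.smul_def]
    ring
  have hb : ∀ x, B x (mulLeftB p q r x) = 0 := fun x => by
    rw [hB, ← map_zero ℓ]
    congr 1
    rw [hβ]
    simp only [mulLeftB, LinearMap.coe_mk, AddHom.coe_mk, Algebra.smul_def, map_add, map_sub,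
      map_mul]
    ring
  let s : SymplecticPair F E :=
    { form := B
      endo := mulLeftA p r - mulLeftB p q r
      isAlt := halt
      nondegenerate := ⟨hleft, fun x hx => hleft x fun y => by
        rw [← halt.neg_eq, neg_eq_zero]; exact hx y⟩
      endo_alternating := fun x => by rw [LinearMap.sub_apply, map_sub, ha, hb, sub_zero] }
  have hs : s.IsDifference p q :=
    ⟨mulLeftA p r, mulLeftB p q r, ha, hb, aeval_mulLeftA hp hp2, aeval_mulLeftB hq hq2, rfl⟩
  refine hs.of_isometric (Isometric.symm ?_)
  have hcomp : ∀ f : F[X], aeval s.endo (f.comp (quad (delta p q))) =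
      Algebra.lsmul F F E (AdjoinRoot.mk r f) := by
    intro f
    rw [aeval_comp, show aeval s.endo (quad (delta p q)) = _ from aeval_quad_mulLeft hp2 hq2,
      aeval_algHom_apply, AdjoinRoot.aeval_eq]
  -- The algebra is free of rank 2 over `F[u]`; in particular `1` has order `r(t ^ 2 - δ t)`.
  have hord : HasOrder s.endo ((1, 0, 0, 0) : E) (r.comp (quad (delta p q))) := by
    refine fun g => ⟨fun hg => ?_, fun hg => aeval_apply_of_dvd hg ?_⟩
    · obtain ⟨f₀, f₁, rfl⟩ := exists_eq_comp_quad_add (delta p q) g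
      rw [aeval_add_apply, aeval_mul_apply, hcomp, hcomp, aeval_X] at hg
      have hone : s.endo ((1, 0, 0, 0) : E) = (0, 1, -1, 0) := by
        change (mulLeftA p r - mulLeftB p q r) ((1, 0, 0, 0) : R × R × R × R) = (0, 1, -1, 0)
        simp [mulLeftA, mulLeftB]
      rw [hone] at hg
      have h0 : AdjoinRoot.mk r f₀ * 1 + AdjoinRoot.mk r f₁ * 0 = 0 :=
        congrArg (fun z : E => z.1) hg
      have h1 : AdjoinRoot.mk r f₀ * 0 + AdjoinRoot.mk r f₁ * 1 = 0 :=
        congrArg (fun z : E => z.2.1) hg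
      rw [mul_one, mul_zero, add_zero] at h0
      rw [mul_one, mul_zero, zero_add] at h1
      rw [AdjoinRoot.mk_eq_zero] at h0 h1
      obtain ⟨⟨k₀, rfl⟩, ⟨k₁, rfl⟩⟩ := And.intro h0 h1
      rw [mul_comp, mul_comp]
      exact dvd_add (dvd_mul_right _ _) ((dvd_mul_right _ _).mul_right _)
    · rw [hcomp, AdjoinRoot.mk_self, map_zero, LinearMap.zero_apply]
  obtain ⟨Φ, hΦ, hΦu⟩ := s.exists_hyperbolic_embedding (h' := 1) (monic_comp_quad hr _)
    isCoprime_one_right (fun x => by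
      rw [mul_one, hcomp, AdjoinRoot.mk_self, map_zero, LinearMap.zero_apply]) hord hc
  have hinj := injective_of_form_eq (s := extension c) hΦ
  -- By dimension, the hyperbolic plane containing the cyclic subspace of `1` is the whole algebra.
  have hdim : finrank F (L × Dual F L) = finrank F E := by
    simp only [E, finrank_prod, Subspace.dual_finrank_eq, hR, hc.finrank_eq, natDegree_comp_quad]
    ring
  exact ⟨Φ.linearEquivOfInjective hinj hdim, hΦ, fun z => (hΦu z).symm⟩

end RegularRepresentation

end SymplecticPair

namespace SymplecticPair

/-! ### Decomposition of balanced symplectic pairs -/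

section Decomposition

open Module

variable {F V W : Type*} [Field F] [AddCommGroup V] [Module F V] [AddCommGroup W] [Module F W]

theorem Isometric.isBalanced {δ : F} {s : SymplecticPair F V} {t : SymplecticPair F W}
    (h : s.Isometric t) (hs : IsBalanced δ s.endo) : IsBalanced δ t.endo := by
  obtain ⟨φ, -, hφ⟩ := h
  exact hs.congr φ fun x => (hφ x).symm

/-- The minimal polynomial of a balanced endomorphism is a polynomial in `t ^ 2 - δ t`. -/
theorem isCompQuad_minpoly [FiniteDimensional F V] {δ : F} {u : Module.End F V}
    (hu : IsBalanced δ u) : IsCompQuad δ (minpoly F u) := by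
  have hdvd : ∀ g : F[X], (∀ x, aeval u g x = 0) ↔ minpoly F u ∣ g := fun g => by
    rw [minpoly.dvd_iff, LinearMap.ext_iff]
    rfl
  have hinf : ∀ g : F[X], (∀ x, aeval u g x = 0) ↔ finrank F (LinearMap.ker (aeval u g)) =
      finrank F V := fun g => by
    refine ⟨fun h => ?_, fun h x => ?_⟩
    · rw [show LinearMap.ker (aeval u g) = ⊤ from
        LinearMap.ker_eq_top.2 (LinearMap.ext h), finrank_top]
    · rw [← LinearMap.mem_ker, Submodule.eq_top_of_finrank_eq h]
      trivial
  refine isCompQuad_of_annihilator (minpoly.ne_zero (Algebra.IsIntegral.isIntegral u)) hdvd ?_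
    hu.mem_range
  -- The kernel of the reflected minimal polynomial has full dimension.
  rw [← hdvd, hinf, ← hu.finrank_ker, ← hinf, hdvd]

/-- A nonzero balanced symplectic pair splits off the symplectic extension of a cyclic endomorphism
with minimal polynomial `r ^ n (t ^ 2 - δ t)`, where `r` is irreducible. The complement is again
balanced. -/
theorem exists_isometric_orthogonalSum_extension [FiniteDimensional F V] [Nontrivial V] {δ : F}
    (s : SymplecticPair F V) (hs : IsBalanced δ s.endo) :
    ∃ (n : ℕ) (r : F[X]), 0 < n ∧ r.Monic ∧ Irreducible r ∧
      (∃ x, HasOrder s.endo x ((r ^ n).comp (quad δ))) ∧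
      ∃ (X Y : Submodule F V) (s₁ : SymplecticPair F X) (s₂ : SymplecticPair F Y),
        s.Isometric (s₁.orthogonalSum s₂) ∧
        s₁.Isometric (extension (Matrix.toLin' (companionMatrix ((r ^ n).comp (quad δ))))) ∧
        IsBalanced δ s₂.endo := by
  have hint : IsIntegral F s.endo := Algebra.IsIntegral.isIntegral s.endo
  obtain ⟨f, hf⟩ := isCompQuad_minpoly hs
  have hf0 : f ≠ 0 := by
    rintro rfl
    rw [zero_comp] at hf
    exact minpoly.ne_zero hint hf
  have hfu : ¬ IsUnit f := by
    intro hu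
    obtain ⟨a, -, rfl⟩ := Polynomial.isUnit_iff.1 hu
    have := minpoly.natDegree_pos hint
    rw [hf, C_comp, natDegree_C] at this
    exact this.false
  obtain ⟨r, hrm, hr, hrf⟩ := Polynomial.exists_monic_irreducible_factor f hfu
  obtain ⟨n, f', hrf', rfl⟩ := WfDvdMonoid.max_power_factor hf0 hr
  have hn : 0 < n := by
    rcases Nat.eq_zero_or_pos n with rfl | h
    · rw [pow_zero, one_mul] at hrf
      exact absurd hrf hrf'
    · exact h
  have hrn : (r ^ n).Monic := hrm.pow n
  have hh : ((r ^ n).comp (quad δ)).Monic := monic_comp_quad hrn δ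
  have hpos : 0 < ((r ^ n).comp (quad δ)).natDegree := by
    rw [natDegree_comp_quad, natDegree_pow]
    have := hr.natDegree_pos
    positivity
  have hcop : IsCoprime ((r ^ n).comp (quad δ)) (f'.comp (quad δ)) :=
    ((hr.coprime_iff_not_dvd.2 hrf').pow_left).map (compRingHom (quad δ))
  rw [mul_comp] at hf
  obtain ⟨x, hx⟩ := exists_hasOrder_of_dvd s.endo (d := (r ^ n).comp (quad δ))
    (hf ▸ dvd_mul_right _ _)
  obtain ⟨e, hc⟩ := isCyclicVector_companionMatrix hh hpos
  obtain ⟨Φ, hΦ, hΦu⟩ := s.exists_hyperbolic_embedding hh hcop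
    (fun y => by rw [← hf, minpoly.aeval, LinearMap.zero_apply]) hx hc
  obtain ⟨X, Y, s₁, s₂, h12, h1⟩ := exists_isometric_orthogonalSum hΦ hΦu
  have hb1 : IsBalanced δ s₁.endo :=
    h1.symm.isBalanced (isBalanced_extension_iff.2 (hc.isBalanced hh.ne_zero ⟨_, rfl⟩))
  exact ⟨n, r, hn, hrm, hr, ⟨x, hx⟩, X, Y, s₁, s₂, h12, h1, hb1.snd (h12.isBalanced hs)⟩

theorem isDifference_of_subsingleton [Subsingleton V] (p q : F[X]) (s : SymplecticPair F V) :
    s.IsDifference p q :=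
  ⟨0, 0, fun x => by simp, fun x => by simp, LinearMap.ext fun x => Subsingleton.elim _ _,
    LinearMap.ext fun x => Subsingleton.elim _ _, LinearMap.ext fun x => Subsingleton.elim _ _⟩

theorem isDifference_of_isometric_companionMatrix {p q : F[X]} (hp : p.Monic)
    (hp2 : p.natDegree = 2) (hq : q.Monic) (hq2 : q.natDegree = 2) {r : F[X]} (hr : r.Monic)
    (hr0 : 0 < r.natDegree) {s : SymplecticPair F V}
    (hs : s.Isometric
      (extension (Matrix.toLin' (companionMatrix (r.comp (quad (delta p q))))))) :
    s.IsDifference p q := by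
  obtain ⟨e, hc⟩ := isCyclicVector_companionMatrix (monic_comp_quad hr (delta p q))
    (by rw [natDegree_comp_quad]; positivity)
  exact (isDifference_extension_of_isCyclicVector hp hp2 hq hq2 hr hc).of_isometric hs.symm

/-- The balanced symplectic pairs are symplectic `(p, q)`-differences. -/
theorem isDifference_of_isBalanced {p q : F[X]} (hp : p.Monic) (hp2 : p.natDegree = 2)
    (hq : q.Monic) (hq2 : q.natDegree = 2) {V : Type*} [AddCommGroup V] [Module F V]
    [FiniteDimensional F V] (s : SymplecticPair F V) (hs : IsBalanced (delta p q) s.endo) :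
    s.IsDifference p q := by
  induction hd : finrank F V using Nat.strong_induction_on generalizing V with
  | _ d ih =>
    rcases subsingleton_or_nontrivial V with hV | hV
    · exact s.isDifference_of_subsingleton p q
    obtain ⟨n, r, hn, hrm, hr, -, X, Y, s₁, s₂, h12, h1, hs₂⟩ :=
      s.exists_isometric_orthogonalSum_extension hs
    have hpos : 0 < (r ^ n).natDegree := by
      rw [natDegree_pow]
      exact Nat.mul_pos hn hr.natDegree_pos
    have hY : finrank F Y < d := by
      obtain ⟨φ, -⟩ := h12
      obtain ⟨ψ, -⟩ := h1
      have h3 := φ.finrank_eq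
      have h4 := ψ.finrank_eq
      rw [finrank_prod] at h3 h4
      rw [finrank_fin_fun, natDegree_comp_quad] at h4
      omega
    have h := (isDifference_of_isometric_companionMatrix hp hp2 hq hq2 (hrm.pow n) hpos
      h1).orthogonalSum (ih _ hY s₂ hs₂ rfl)
    exact h.of_isometric h12.symm

end Decomposition

/-! ### Classification of the regular symplectic differences -/

section Classification

open Module

variable {F V W : Type*} [Field F] [AddCommGroup V] [Module F V] [AddCommGroup W] [Module F W]

theorem isRegular_extension_iff [FiniteDimensional F V] {p q : F[X]} {v : Module.End F V} :
    IsRegular p q (extension v).endo ↔ IsRegular p q v := by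
  rw [isRegular_iff_finrank_ker, isRegular_iff_finrank_ker]
  rw [extension, finrank_ker_aeval_prodMap, finrank_ker_aeval_dualMap]
  omega

theorem Isometric.finrank_ker_aeval_orthogonalSum {U : Type*} [AddCommGroup U] [Module F U]
    [FiniteDimensional F V] [FiniteDimensional F W] {s : SymplecticPair F U}
    {s₁ : SymplecticPair F V} {s₂ : SymplecticPair F W} (h : s.Isometric (s₁.orthogonalSum s₂))
    (g : F[X]) :
    finrank F (LinearMap.ker (aeval s.endo g)) = finrank F (LinearMap.ker (aeval s₁.endo g)) +
      finrank F (LinearMap.ker (aeval s₂.endo g)) := by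
  obtain ⟨φ, -, hφ⟩ := h
  rw [finrank_ker_aeval_congr φ (fun x => (hφ x).symm), ← finrank_ker_aeval_prodMap]
  rfl

theorem finrank_ker_aeval_extension_of_dvd [FiniteDimensional F V] {c : Module.End F V} {e : V}
    {g h : F[X]} (hc : IsCyclicVector c e h) (hh : h ≠ 0) (hg : g ∣ h) :
    finrank F (LinearMap.ker (aeval (extension c).endo g)) = 2 * g.natDegree := by
  classical
  rw [extension, finrank_ker_aeval_prodMap, finrank_ker_aeval_dualMap, hc.finrank_ker_aeval hh,
    two_mul]
  have h1 : EuclideanDomain.gcd g h = g := EuclideanDomain.gcd_eq_left.2 hg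
  convert rfl <;> exact h1.symm

/-- If a power of `r(t ^ 2 - δ t)` annihilates a nonzero balanced symplectic pair, then the kernel
of `r(t ^ 2 - δ t)` is at least as large as for a single hyperbolic summand. -/
theorem two_mul_natDegree_le_finrank_ker [FiniteDimensional F V] [Nontrivial V] {δ : F}
    {s : SymplecticPair F V} (hs : IsBalanced δ s.endo) {r : F[X]} (hrm : r.Monic)
    (hr : Irreducible r) {n : ℕ} (hn : ∀ x, aeval s.endo ((r ^ n).comp (quad δ)) x = 0) :
    2 * (r.comp (quad δ)).natDegree ≤
      finrank F (LinearMap.ker (aeval s.endo (r.comp (quad δ)))) := by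
  obtain ⟨m, r', hm, hrm', hr', ⟨x, hx⟩, X, Y, s₁, s₂, h12, ⟨φ, -, hφ⟩, -⟩ :=
    s.exists_isometric_orthogonalSum_extension hs
  obtain rfl : r' = r := by
    have h1 := comp_quad_dvd_comp_quad δ ((hx _).1 (hn x))
    exact eq_of_monic_of_associated hrm' hrm (hr'.associated_of_dvd hr
      (hr'.prime.dvd_of_dvd_pow ((dvd_pow_self r' hm.ne').trans h1)))
  have hh : ((r' ^ m).comp (quad δ)).Monic := monic_comp_quad (hrm.pow m) δ
  have hpos : 0 < ((r' ^ m).comp (quad δ)).natDegree := by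
    rw [natDegree_comp_quad, natDegree_pow]
    have := hr.natDegree_pos
    positivity
  obtain ⟨e, hc⟩ := isCyclicVector_companionMatrix hh hpos
  rw [h12.finrank_ker_aeval_orthogonalSum, finrank_ker_aeval_congr φ (fun x => (hφ x).symm),
    finrank_ker_aeval_extension_of_dvd hc hh.ne_zero
      (by rw [pow_comp]; exact dvd_pow_self _ hm.ne')]
  exact Nat.le_add_right _ _

theorem isRegular_of_isCoprime [FiniteDimensional F V] {p q h : F[X]} {u : Module.End F V}
    (hcop : IsCoprime (fundamentalPoly p q) h) (hu : ∀ x, aeval u h x = 0) : IsRegular p q u := by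
  rw [isRegular_iff, injective_iff_map_eq_zero]
  intro x hx
  obtain ⟨α, β, hαβ⟩ := hcop
  have h1 : aeval u (α * fundamentalPoly p q + β * h) x = x := by rw [hαβ]; simp
  rwa [aeval_add_apply, aeval_mul_apply, aeval_mul_apply, hx, hu, map_zero, map_zero, add_zero,
    eq_comm] at h1

/-- A common divisor of `F_{p,q}` and of the order of a vector yields a vector annihilated by
`F_{p,q}(u)`. -/
theorem isCoprime_of_isRegular [FiniteDimensional F V] {p q h : F[X]} {u : Module.End F V}
    (hreg : IsRegular p q u) (h0 : h ≠ 0) {x : V} (hx : HasOrder u x h) :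
    IsCoprime (fundamentalPoly p q) h := by
  rw [← isRelPrime_iff_isCoprime]
  rintro d hd ⟨k, rfl⟩
  have h1 : aeval u k x = 0 := by
    refine (injective_iff_map_eq_zero _).1
      (injective_aeval_of_dvd hd (isRegular_iff.1 hreg)) _ ?_
    rw [← aeval_mul_apply, hx.aeval_self]
  have h2 := (hx k).1 h1
  have hk : k ≠ 0 := right_ne_zero_of_mul h0
  exact isUnit_of_dvd_one ((mul_dvd_mul_iff_right hk).1 (by rwa [one_mul]))

variable {p q : F[X]}

theorem tfae_isDifference_extension (hp : p.Monic) (hp2 : p.natDegree = 2) (hq : q.Monic)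
    (hq2 : q.natDegree = 2) [FiniteDimensional F V] {v : Module.End F V} (hv : IsRegular p q v) :
    List.TFAE [(extension v).IsDifference p q,
      ∀ f : F[X], IsInvariantFactor v f → IsPolyInQuad p q f,
      ∀ f : F[X], IsInvariantFactor (extension v).endo f → IsPolyInQuad p q f] := by
  tfae_have 1 → 3 := fun h f hf => isCompQuad_of_isBalanced
    (isBalanced_of_isDifference hp hp2 hq hq2 (isRegular_extension_iff.2 hv) h) hf
  tfae_have 3 → 2 := fun h f hf => isCompQuad_of_isBalanced
    (isBalanced_extension_iff.1 (isBalanced_of_forall_isCompQuad h)) hf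
  tfae_have 2 → 1 := fun h => isDifference_of_isBalanced hp hp2 hq hq2 _
    (isBalanced_extension_iff.2 (isBalanced_of_forall_isCompQuad h))
  tfae_finish

/-- In a nontrivial decomposition, each summand would contribute at least `2 deg r(t ^ 2 - δ t)` to
the dimension of the kernel of `r(t ^ 2 - δ t)`, which is exactly that number. -/
theorem isIndecomposableDifference_extension (hp : p.Monic) (hp2 : p.natDegree = 2)
    (hq : q.Monic) (hq2 : q.natDegree = 2) {n : ℕ} {r : F[X]} (hr : IsRegularDatum p q n r)
    [FiniteDimensional F V] {v : Module.End F V} {e : V}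
    (hv : IsCyclicVector v e ((r ^ n).comp (quad (delta p q)))) :
    IsRegular p q (extension v).endo ∧ (extension v).IsIndecomposableDifference p q := by
  have hrn : (r ^ n).Monic := hr.monic.pow n
  have hh : ((r ^ n).comp (quad (delta p q))).Monic := monic_comp_quad hrn _
  have hrpos := hr.irreducible.natDegree_pos
  have hnpos := hr.pos
  have hcop : IsCoprime (fundamentalPoly p q) ((r ^ n).comp (quad (delta p q))) := by
    rw [pow_comp]
    exact ((isCoprime_fundamentalPoly_iff hp hp2 hq hq2 _).2 hr.no_root).pow_right
  have hreg : IsRegular p q (extension v).endo :=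
    isRegular_extension_iff.2 (isRegular_of_isCoprime hcop hv.aeval_apply_eq_zero)
  refine ⟨hreg, ?_, isDifference_extension_of_isCyclicVector hp hp2 hq hq2 hrn hv, ?_⟩
  · have : 0 < finrank F V := by
      rw [hv.finrank_eq, natDegree_comp_quad, natDegree_pow]
      positivity
    have := Module.nontrivial_of_finrank_pos this
    infer_instance
  · intro V₁ V₂ _ _ _ _ _ _ _ _ s₁ s₂ h1 h2 h12
    have hF := h12.finrank_ker_aeval_orthogonalSum (fundamentalPoly p q)
    rw [isRegular_iff_finrank_ker.1 hreg] at hF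
    have hb1 := isBalanced_of_isDifference hp hp2 hq hq2 (isRegular_iff_finrank_ker.2 (by omega)) h1
    have hb2 := isBalanced_of_isDifference hp hp2 hq hq2 (isRegular_iff_finrank_ker.2 (by omega)) h2
    have hz : ∀ z, aeval (s₁.orthogonalSum s₂).endo ((r ^ n).comp (quad (delta p q))) z = 0 := by
      obtain ⟨φ, -, hφ⟩ := h12
      intro z
      obtain ⟨y, rfl⟩ := φ.surjective z
      refine (map_aeval_apply (φ := (φ : V × Dual F V →ₗ[F] V₁ × V₂))
        (fun x => (hφ x).symm) _ y).symm.trans ?_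
      rw [extension, aeval_prodMap_apply]
      refine φ.map_eq_zero_iff.2 (Prod.ext (hv.aeval_apply_eq_zero _) (LinearMap.ext fun x => ?_))
      rw [aeval_dualMap_apply, hv.aeval_apply_eq_zero, map_zero]
      rfl
    have hk1 := two_mul_natDegree_le_finrank_ker hb1 hr.monic hr.irreducible (n := n) fun x => by
      have := hz (x, 0)
      rw [orthogonalSum, aeval_prodMap_apply] at this
      exact congrArg Prod.fst this
    have hk2 := two_mul_natDegree_le_finrank_ker hb2 hr.monic hr.irreducible (n := n) fun x => by
      have := hz (0, x)
      rw [orthogonalSum, aeval_prodMap_apply] at this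
      exact congrArg Prod.snd this
    have hk := h12.finrank_ker_aeval_orthogonalSum (r.comp (quad (delta p q)))
    rw [finrank_ker_aeval_extension_of_dvd hv hh.ne_zero
      (by rw [pow_comp]; exact dvd_pow_self _ hr.pos.ne')] at hk
    rw [natDegree_comp_quad] at hk hk1 hk2
    omega

theorem IsIndecomposableDifference.exists_isometric (hp : p.Monic) (hp2 : p.natDegree = 2)
    (hq : q.Monic) (hq2 : q.natDegree = 2) [FiniteDimensional F V] {s : SymplecticPair F V}
    (hs : s.IsIndecomposableDifference p q) (hreg : IsRegular p q s.endo) :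
    ∃ (n : ℕ) (r : F[X]), IsRegularDatum p q n r ∧
      s.Isometric (extension (Matrix.toLin' (regularMatrix p q n r))) := by
  obtain ⟨hV, hdiff, hind⟩ := hs
  obtain ⟨n, r, hn, hrm, hr, ⟨x, hx⟩, X, Y, s₁, s₂, h12, h1, hb2⟩ :=
    s.exists_isometric_orthogonalSum_extension
      (isBalanced_of_isDifference hp hp2 hq hq2 hreg hdiff)
  have hpos : 0 < (r ^ n).natDegree := by
    rw [natDegree_pow]
    exact Nat.mul_pos hn hr.natDegree_pos
  refine ⟨n, r, ⟨hn, hrm, hr, ?_⟩, ?_⟩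
  · refine (isCoprime_fundamentalPoly_iff hp hp2 hq hq2 _).1 ?_
    have h := isCoprime_of_isRegular hreg (comp_quad_ne_zero _ (hrm.pow n).ne_zero) hx
    rw [pow_comp] at h
    exact (IsCoprime.pow_right_iff hn).1 h
  · have hX : Nontrivial X := by
      obtain ⟨ψ, -⟩ := h1
      have h := ψ.finrank_eq
      rw [finrank_prod, finrank_fin_fun, natDegree_comp_quad] at h
      exact Module.nontrivial_of_finrank_pos (R := F) (by omega)
    rcases subsingleton_or_nontrivial Y with hY | hY
    · refine Isometric.trans ?_ h1
      obtain ⟨φ, h3, h4⟩ := h12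
      have : Unique Y := uniqueOfSubsingleton 0
      refine ⟨φ.trans LinearEquiv.prodUnique, fun x y => ?_, fun x => ?_⟩
      · rw [← h3, orthogonalSum, orthogonalSumForm_apply, Subsingleton.elim (φ x).2 0, map_zero,
          LinearMap.zero_apply, add_zero]
        rfl
      · exact congrArg Prod.fst (h4 x)
    · exact absurd h12 (hind X Y s₁ s₂
        (isDifference_of_isometric_companionMatrix hp hp2 hq hq2 (hrm.pow n) hpos h1)
        (isDifference_of_isBalanced hp hp2 hq hq2 s₂ hb2))

end Classification

end SymplecticPair

end

end SymplecticDifference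

open SymplecticDifference in
theorem mainTheorem3 {F : Type*} [Field F] (p q : F[X])
    (hp : p.Monic) (hp2 : p.natDegree = 2) (hq : q.Monic) (hq2 : q.natDegree = 2) :
    (∀ (V : Type*) [AddCommGroup V] [Module F V] [FiniteDimensional F V] (v : Module.End F V),
      IsRegular p q v →
        List.TFAE
          [(SymplecticPair.extension v).IsDifference p q,
            ∀ f : F[X], IsInvariantFactor v f → IsPolyInQuad p q f,
            ∀ f : F[X], IsInvariantFactor (SymplecticPair.extension v).endo f →
              IsPolyInQuad p q f]) ∧
    (∀ (n : ℕ) (r : F[X]), IsRegularDatum p q n r →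
      ∀ (V : Type*) [AddCommGroup V] [Module F V] [FiniteDimensional F V] (v : Module.End F V)
        (e : Module.Basis (Fin ((r ^ n).comp (quadPoly p q)).natDegree) F V),
        LinearMap.toMatrix e e v = regularMatrix p q n r →
          IsRegular p q (SymplecticPair.extension v).endo ∧
            (SymplecticPair.extension v).IsIndecomposableDifference p q) ∧
    (∀ (V : Type*) [AddCommGroup V] [Module F V] [FiniteDimensional F V]
      (s : SymplecticPair F V),
      IsRegular p q s.endo → s.IsIndecomposableDifference p q →
        ∃ (n : ℕ) (r : F[X]), IsRegularDatum p q n r ∧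
          s.Isometric (SymplecticPair.extension (Matrix.toLin' (regularMatrix p q n r)))) := by
  refine ⟨fun V _ _ _ v hv => SymplecticPair.tfae_isDifference_extension hp hp2 hq hq2 hv,
    fun n r hr V _ _ _ v e he => ?_,
    fun V _ _ _ s hreg hs => hs.exists_isometric hp hp2 hq hq2 hreg⟩
  have hpos : 0 < ((r ^ n).comp (quadPoly p q)).natDegree := by
    have h := natDegree_comp_quad (delta p q) (r ^ n)
    rw [Polynomial.natDegree_pow] at h
    exact h ▸ Nat.mul_pos (Nat.mul_pos hr.pos hr.irreducible.natDegree_pos) two_pos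
  exact SymplecticPair.isIndecomposableDifference_extension hp hp2 hq hq2 hr
    (isCyclicVector_of_toMatrix_eq (monic_comp_quad (hr.monic.pow n) _) hpos e he)
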